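/- Let $n,N$ be positive integers, write $\langle n\rangle=\{1,\dots,n\}$, and let $\Theta$ be a set partition of $\langle n\rangle$ with $k=|\Theta|$ blocks. **Combinatorial notation.** A *bond* is a two-element subset of $\langle n\rangle$. Partitions are ordered by refinement, with greatest element $\mathbf 1_n=\{\langle n\rangle\}$. For a set $\Gamma$ of bonds, $\Gamma\vee\Theta$ is the finest partition of $\langle n\rangle$ that is coarser than or equal to $\Theta$ and has each member of $\Gamma$ contained in one of its blocks. $\mathrm{Tree}_n(\Theta)$ is the set of all sets $\Gamma$ of bonds with $\Gamma\vee\Theta=\mathbf 1_n$ and $|\Gamma|+1=|\Theta|$. For a partition $\Pi$, $[\Pi]$ is the $n\times n$ matrix with $[\Pi](i,j)=1$ if $i,j$ lie in the same block of $\Pi$ and $0$ otherwise. $\mathfrak Q_n$ is the set of real symmetric positive semidefinite $n\times n$ matrices with all entries in $[0,1]$ and all diagonal entries equal to $1$. **The measures.** For $\Gamma\in\mathrm{Tree}_n(\Theta)$, $\mathbb P^\Theta_\Gamma$ is the measure determined by $$\int F\,d\mathbb P^\Theta_\Gamma=\sum_{(e_1,\dots,e_{k-1}):\,\{e_1,\dots,e_{k-1}\}=\Gamma}\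 \int_{1>t_1>\cdots>t_{k-1}>0}F\Big([\Theta]+\sum_{\alpha=1}^{k-1}t_\alpha\big([\{e_1,\dots,e_\alpha\}\vee\Theta]-[\{e_1,\dots,e_{\alpha-1}\}\vee\Theta]\big)\Big)\,dt_1\cdots dt_{k-1}$$ for continuous functions $F$ on $\mathfrak Q_n$. **Polynomials and operators.** Let $z=\{z_{ij}\}_{1\le i\le n,\,0\le j\le 2N}$ be commuting variables. For a bond $e=\{i,i'\}$ put $D_e=\sum_{j=0}^{2N}\frac{\partial^2}{\partial z_{ij}\partial z_{i'j}}$, and put $D^\Gamma=\prod_{e\in\Gamma}D_e$. For each block $A\in\Theta$ let $f_A\in\mathbb R[\{z_{ij}\}_{i\in A,\,0\le j\le 2N}]$, and let $f=\prod_{A\in\Theta}f_A$. **Gaussian families.** Let $\zeta=\{\zeta_{ij}\}_{1\le i\le n,\,0\le j\le 2N}$ be real random variables with a centred (possibly degenerate) Gaussian joint distribution such that $\mathbf E\,\zeta_{ij}\zeta_{i'j'}=\delta_{jj'}\,\mathbf E\,\zeta_{i0}\zeta_{i'0}$. For $Q\in\mathfrak Q_n$, $\zeta\star Q$ denotes any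 family of real random variables with a centred Gaussian joint distribution and covariances $\mathbf E(\zeta\star Q)_{ij}(\zeta\star Q)_{i'j'}=Q(i,i')\,\mathbf E\,\zeta_{ij}\zeta_{i'j'}$; its probability space may depend on $Q$. **Joint cumulant.** For a finite family $\{X_s\}_{s\in S}$ of random variables with absolute moments of all orders, $\kappa(\{X_s\}_{s\in S})=\big(\prod_{s\in S}\frac{\partial}{\partial t_s}\big)\log\mathbf E\exp\big(\sum_{s\in S}t_sX_s\big)\big|_{t=0}$, where the variables $t_s$ are treated formally. **Theorem.** The variables $f_A(\zeta)$ have absolute moments of all orders. For each $Q\in\mathfrak Q_n$ a family $\zeta\star Q$ exists and its law is uniquely determined. Each $\mathbb P^\Theta_\Gamma$, $\Gamma\in\mathrm{Tree}_n(\Theta)$, is a probability measure on $\mathfrak Q_n$. For every $g\in\mathbb R[z]$ and $\Gamma\in\mathrm{Tree}_n(\Theta)$, the random variable $g(\zeta\star Q)$ is integrable for every $Q\in\mathfrak Q_n$, and $Q\mapsto\mathbf E[g(\zeta\star Q)]$ is $\mathbb P^\Theta_\Gamma$-integrable. Finally, $$\kappa\big(\{f_A(\zeta)\}_{A\in\Theta}\big)=\sum_{\Gamma\in\mathrm{Tree}_n(\Theta)}\Big(\prod_{\{i,i'\}\in\Gamma}\mathbf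 E\,\zeta_{i0}\zeta_{i'0}\Big)\int\mathbf E\big[(D^\Gamma f)(\zeta\star Q)\big]\,\mathbb P^\Theta_\Gamma(dQ).$$ -/

import Mathlib

open MeasureTheory ProbabilityTheory

noncomputable section

namespace BKAR

/-! ### Joint cumulants -/

/-- The formal moment generating series `E exp (∑ i, t i * X i)`, a formal power series in the
variables `t i`: the coefficient of `t ^ ν` is `E (∏ i, X i ^ ν i) / ∏ i, (ν i)!`. -/
def formalMGF {Ω S : Type*} [MeasurableSpace Ω] [Fintype S] (P : Measure Ω) (X : S → Ω → ℝ) :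
    MvPowerSeries S ℝ :=
  fun ν => (∫ ω, ∏ i, X i ω ^ ν i ∂P) / ∏ i, ((ν i).factorial : ℝ)

/-- The joint cumulant `(∏ i, ∂/∂t i) log E exp (∑ i, t i * X i)` at `t = 0`, all variables `t i`
being treated formally. `PowerSeries.log ℝ` is the series of `log (1 + X)`, and the value at `t = 0`
of the derivative, once in each variable, is the coefficient of `∏ i, t i`. -/
def jointCumulant {Ω S : Type*} [MeasurableSpace Ω] [Fintype S] (P : Measure Ω)
    (X : S → Ω → ℝ) : ℝ :=
  MvPowerSeries.coeff (Finsupp.equivFunOnFinite.symm fun _ : S => 1)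
    ((PowerSeries.log ℝ).subst (formalMGF P X - 1))

/-! ### Partitions, bonds and trees -/

/-- Set partitions of an `n`-element set, ordered by refinement. -/
abbrev SetPart (n : ℕ) : Type := Finpartition (Finset.univ : Finset (Fin n))

/-- The bonds: two-element subsets `{i, j}`, `i ≠ j`. -/
def bonds (n : ℕ) : Finset (Sym2 (Fin n)) := Finset.univ.filter fun e => ¬ e.IsDiag

open scoped Classical in
/-- `Γ ∨ Θ`: the greatest lower bound of the partitions that are coarser than `Θ` and have
each member of `Γ` contained in one of their blocks. -/
def join {n : ℕ} (Γ : Finset (Sym2 (Fin n))) (Θ : SetPart n) : SetPart n :=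
  (Finset.univ.filter fun Ψ : SetPart n =>
    Θ ≤ Ψ ∧ ∀ e ∈ Γ, ∃ B ∈ Ψ.parts, ∀ i ∈ e, i ∈ B).inf id

open scoped Classical in
/-- The sets of bonds `Γ` with `Γ ∨ Θ = 1` and `|Γ| + 1 = |Θ|`. -/
def trees {n : ℕ} (Θ : SetPart n) : Finset (Finset (Sym2 (Fin n))) :=
  (bonds n).powerset.filter fun Γ => join Γ Θ = ⊤ ∧ Γ.card + 1 = Θ.parts.card

open scoped Classical in
/-- The zero-one matrix `[Ψ]` representing a partition. -/
def partMatrix {n : ℕ} (Ψ : SetPart n) : Matrix (Fin n) (Fin n) ℝ :=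
  Matrix.of fun i j => if ∃ A ∈ Ψ.parts, i ∈ A ∧ j ∈ A then 1 else 0

/-- The symmetric positive semidefinite matrices with entries in `[0, 1]` and unit diagonal. -/
def couplings (n : ℕ) : Set (Matrix (Fin n) (Fin n) ℝ) :=
  {Q | Q.PosSemidef ∧ (∀ i j, Q i j ∈ Set.Icc (0 : ℝ) 1) ∧ ∀ i, Q i i = 1}

/-! ### The tree measures -/

instance matrixMeasurableSpace {n : ℕ} : MeasurableSpace (Matrix (Fin n) (Fin n) ℝ) :=
  inferInstanceAs (MeasurableSpace (Fin n → Fin n → ℝ))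

instance matrixBorelSpace {n : ℕ} : BorelSpace (Matrix (Fin n) (Fin n) ℝ) :=
  inferInstanceAs (BorelSpace (Fin n → Fin n → ℝ))

/-- The open simplex `1 > t 0 > ⋯ > t (m - 1) > 0`. -/
def simplex (m : ℕ) : Set (Fin m → ℝ) :=
  {t | StrictAnti t ∧ ∀ α, t α ∈ Set.Ioo (0 : ℝ) 1}

/-- The matrix
`[Θ] + ∑ α, t α • ([{e 0, …, e α} ∨ Θ] - [{e 0, …, e (α - 1)} ∨ Θ])`. -/
def pathMatrix {n m : ℕ} (Θ : SetPart n) (e : Fin m → Sym2 (Fin n)) (t : Fin m → ℝ) :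
    Matrix (Fin n) (Fin n) ℝ :=
  partMatrix Θ + ∑ α, t α • (partMatrix (join ((Finset.Iic α).image e) Θ) -
    partMatrix (join ((Finset.Iio α).image e) Θ))

/-- The measure attached to `Θ` and a tree `Γ`: the sum, over all enumerations
`e 0, …, e (k - 2)` of `Γ`, with `k` the number of blocks of `Θ`, of the images of Lebesgue measure
on the simplex under `pathMatrix Θ e`. -/
def treeMeasure {n : ℕ} (Θ : SetPart n) (Γ : Finset (Sym2 (Fin n))) :
    Measure (Matrix (Fin n) (Fin n) ℝ) :=
  ∑ e ∈ Finset.univ.filter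
      (fun e : Fin (Θ.parts.card - 1) → Sym2 (Fin n) => Finset.univ.image e = Γ),
    ((volume : Measure (Fin (Θ.parts.card - 1) → ℝ)).restrict (simplex _)).map (pathMatrix Θ e)

/-! ### Differential operators -/

/-- The index set of the variables `z i j` with `i` in an `n`-element set and `0 ≤ j ≤ 2N`. -/
abbrev Var (n N : ℕ) : Type := Fin n × Fin (2 * N + 1)

/-- The partial derivative `∂/∂z p` as a linear operator on polynomials. -/
def partialOp {n N : ℕ} (p : Var n N) : Module.End ℝ (MvPolynomial (Var n N) ℝ) :=
  (MvPolynomial.pderiv p : Derivation ℝ (MvPolynomial (Var n N) ℝ) _).toLinearMap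

theorem partialOp_commute {n N : ℕ} (p q : Var n N) :
    Commute (partialOp p) (partialOp q) := by
  have h : ⁅(MvPolynomial.pderiv p : Derivation ℝ (MvPolynomial (Var n N) ℝ) (MvPolynomial (Var n N) ℝ)),
      (MvPolynomial.pderiv q : Derivation ℝ (MvPolynomial (Var n N) ℝ) (MvPolynomial (Var n N) ℝ))⁆ = 0 := by
    apply MvPolynomial.derivation_ext
    intro i
    rw [Derivation.commutator_apply]
    simp only [MvPolynomial.pderiv_X, Pi.single_apply, Derivation.zero_apply]
    split_ifs <;> simp
  apply LinearMap.ext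
  intro g
  have hg := DFunLike.congr_fun h g
  rw [Derivation.commutator_apply, Derivation.zero_apply, sub_eq_zero] at hg
  exact hg

/-- `D_e = ∑ j, ∂²/∂z i j ∂z i' j` for `e = {i, i'}`. -/
def bondOp {n : ℕ} (N : ℕ) : Sym2 (Fin n) → Module.End ℝ (MvPolynomial (Var n N) ℝ) :=
  Sym2.lift ⟨fun i i' => ∑ j : Fin (2 * N + 1), partialOp (i, j) * partialOp (i', j),
    fun i i' => Finset.sum_congr rfl fun j _ => partialOp_commute (i, j) (i', j)⟩

theorem bondOp_commute {n N : ℕ} (e e' : Sym2 (Fin n)) :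
    Commute (bondOp N e) (bondOp N e') := by
  induction e using Sym2.ind with
  | _ a b =>
    induction e' using Sym2.ind with
    | _ c d =>
      simp only [bondOp, Sym2.lift_mk]
      refine Commute.sum_left _ _ _ fun j _ => Commute.sum_right _ _ _ fun j' _ => ?_
      exact ((partialOp_commute _ _).mul_right (partialOp_commute _ _)).mul_left
        ((partialOp_commute _ _).mul_right (partialOp_commute _ _))

/-- `D^Γ`, the product of the commuting operators `D_e`, `e ∈ Γ`. -/
def treeOp {n : ℕ} (N : ℕ) (Γ : Finset (Sym2 (Fin n))) :
    Module.End ℝ (MvPolynomial (Var n N) ℝ) :=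
  Γ.noncommProd (bondOp N) fun e _ e' _ _ => bondOp_commute e e'

/-! ### Gaussian families -/

/-- The family `X` has a centred (possibly degenerate) Gaussian joint distribution under `P`. -/
structure IsCentredGaussian {Ω S : Type*} [MeasurableSpace Ω] [Fintype S] (P : Measure Ω)
    (X : S → Ω → ℝ) : Prop where
  gaussian : HasGaussianLaw (fun ω s => X s ω) P
  mean_zero : ∀ s, ∫ ω, X s ω ∂P = 0

/-- The family `ζ'` arises from the family `ζ` by `Q`-recoupling: it is centred Gaussian with
`E (ζ' i j * ζ' i' j') = Q i i' * E (ζ i j * ζ i' j')`. -/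
structure IsRecoupling {n N : ℕ} {Ω Ω' : Type*} [MeasurableSpace Ω] [MeasurableSpace Ω']
    (P : Measure Ω) (ζ : Var n N → Ω → ℝ) (Q : Matrix (Fin n) (Fin n) ℝ)
    (P' : Measure Ω') (ζ' : Var n N → Ω' → ℝ) : Prop where
  centred : IsCentredGaussian P' ζ'
  covariance : ∀ p q : Var n N,
    ∫ ω, ζ' p ω * ζ' q ω ∂P' = Q p.1 q.1 * ∫ ω, ζ p ω * ζ q ω ∂P

/-- `E (ζ i 0 * ζ i' 0)` for `e = {i, i'}`. -/
def bondCov {n N : ℕ} {Ω : Type*} [MeasurableSpace Ω] (P : Measure Ω) (ζ : Var n N → Ω → ℝ) :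
    Sym2 (Fin n) → ℝ :=
  Sym2.lift ⟨fun i i' => ∫ ω, ζ (i, 0) ω * ζ (i', 0) ω ∂P,
    fun i i' => by simp only [mul_comm]⟩

/-- The random variable `g(ζ)` for a polynomial `g`. -/
def polyVar {n N : ℕ} {Ω : Type*} (g : MvPolynomial (Var n N) ℝ) (ζ : Var n N → Ω → ℝ)
    (ω : Ω) : ℝ :=
  MvPolynomial.eval (fun p => ζ p ω) g

end BKAR

end

open BKAR

/-!
For a centred Gaussian family the expectation of a polynomial `g` is the value at `0` of
`exp (½ ∑ p q, c p q ∂_p ∂_q) g`, where `c` is the covariance matrix. Hence `E[g(ζ ⋆ Q)]` is a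
polynomial in the entries of `Q`, whose derivative in the entry at a bond `e` is
`E[ζ_{i0} ζ_{i'0}] E[(D_e g)(ζ ⋆ Q)]`.

Let `F(Q) = E[f(ζ ⋆ Q)]`. Under the coupling `[Ψ]`, where `Ψ` is coarser than `Θ`, distinct blocks
of `Ψ` are independent, so `F([Ψ])` is the product over the blocks of `Ψ` of the mixed moments of
the `f_A(ζ)`. Expanding the logarithm turns the joint cumulant into a fixed linear combination of
the numbers `F([Ψ])`. Applied to a constant this combination vanishes when `Θ` has at least two
blocks, so `F([Ψ])` may be replaced by `F([Ψ]) - F([Θ])`, the integral of the derivative of `F`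
along the segment from `[Θ]` to `[Ψ]`. Only the bonds joining two blocks of `Θ` contribute. For each
such bond `e` the coefficients recombine to the cumulant over the blocks of `{e} ∨ Θ`, and induction
on the number of blocks yields the sum over ordered trees; the lengths travelled along the
successive segments multiply to the simplex parameters `t_1 > ⋯ > t_{k-1}`.
-/

noncomputable section

namespace BKAR

/-! ### The Wick functional -/

section PartialDerivatives

open MvPolynomial

variable {V R : Type*} [CommSemiring R]

theorem pderiv_pderiv_comm (p q : V) (g : MvPolynomial V R) :
    pderiv p (pderiv q g) = pderiv q (pderiv p g) := by
  classical
  ext m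
  rcases eq_or_ne p q with rfl | h
  · rfl
  · simp only [coeff_pderiv, Finsupp.add_apply, Finsupp.single_eq_of_ne h,
      Finsupp.single_eq_of_ne h.symm, add_zero, add_right_comm m (Finsupp.single p 1), mul_assoc]
    rw [mul_comm ((m p : R) + 1)]

theorem totalDegree_pderiv_le (p : V) (g : MvPolynomial V R) :
    (pderiv p g).totalDegree ≤ g.totalDegree - 1 := by
  classical
  refine Finset.sup_le fun m hm => ?_
  have hmem : m + Finsupp.single p 1 ∈ g.support := by
    rw [mem_support_iff, coeff_pderiv] at hm
    exact mem_support_iff.2 (left_ne_zero_of_mul hm)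
  have hle := le_totalDegree hmem
  rw [Finsupp.sum_add_index' (fun _ => rfl) fun _ _ _ => rfl, Finsupp.sum_single_index rfl] at hle
  omega

theorem pderiv_eq_zero_of_mem_supported {A : Set V} {g : MvPolynomial V R}
    (hg : g ∈ supported R A) {q : V} (hq : q ∉ A) : pderiv q g = 0 :=
  pderiv_eq_zero_of_notMem_vars fun h => hq (mem_supported.1 hg h)

end PartialDerivatives

section Wick

open MvPolynomial

variable {K V R : Type*} [Field K] [Fintype V] [CommRing R] [Algebra K R]

/-- The operator `½ ∑ p, ∑ q, c p q ∂²/∂z p ∂z q`, which generates the Gaussian semigroup with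
covariances `c`. -/
def contraction (K : Type*) [Field K] [Algebra K R] (c : V → V → R) :
    Module.End R (MvPolynomial V R) :=
  algebraMap K R 2⁻¹ • ∑ p, ∑ q, c p q • ((pderiv p).toLinearMap ∘ₗ (pderiv q).toLinearMap)

theorem contraction_apply (c : V → V → R) (g : MvPolynomial V R) :
    contraction K c g = algebraMap K R 2⁻¹ • ∑ p, ∑ q, c p q • pderiv p (pderiv q g) := by
  simp [contraction]

theorem contraction_pderiv (c : V → V → R) (r : V) (g : MvPolynomial V R) :
    contraction K c (pderiv r g) = pderiv r (contraction K c g) := by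
  simp only [contraction_apply, Derivation.map_smul, map_sum]
  simp only [pderiv_pderiv_comm r]

theorem contraction_pow_pderiv (c : V → V → R) (k : ℕ) (r : V) (g : MvPolynomial V R) :
    (contraction K c ^ k) (pderiv r g) = pderiv r ((contraction K c ^ k) g) := by
  induction k generalizing g with
  | zero => rfl
  | succ k ih => rw [pow_succ, Module.End.mul_apply, Module.End.mul_apply, contraction_pderiv, ih]

theorem contraction_X_mul [CharZero K] {c : V → V → R} (hc : ∀ p q, c p q = c q p) (r : V)
    (g : MvPolynomial V R) :
    contraction K c (X r * g) = X r * contraction K c g + ∑ q, c r q • pderiv q g := by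
  classical
  have leibniz : ∀ p q, c p q • pderiv p (pderiv q (X r * g)) =
      X r * (c p q • pderiv p (pderiv q g)) + (if r = p then c p q • pderiv q g else 0) +
        if r = q then c p q • pderiv p g else 0 := by
    intro p q
    simp only [pderiv_mul, pderiv_X, Pi.single_apply, map_add, ite_mul, one_mul, zero_mul,
      apply_ite (pderiv p), map_zero]
    split_ifs <;> simp [smul_add] <;> ring
  have half : algebraMap K R 2⁻¹ + algebraMap K R 2⁻¹ = 1 := by
    rw [← map_add, ← two_mul, mul_inv_cancel₀ two_ne_zero, map_one]
  simp only [contraction_apply, leibniz, Finset.sum_add_distrib, Finset.sum_ite_irrel,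
    Finset.sum_ite_eq, Finset.mem_univ, if_true, Finset.sum_const_zero, smul_add,
    mul_smul_comm, add_assoc, hc _ r]
  rw [← add_smul, half, one_smul]
  simp only [← mul_smul_comm, ← Finset.mul_sum]

theorem contraction_pow_succ_X_mul [CharZero K] {c : V → V → R} (hc : ∀ p q, c p q = c q p)
    (r : V) (g : MvPolynomial V R) (k : ℕ) :
    (contraction K c ^ (k + 1)) (X r * g) = X r * (contraction K c ^ (k + 1)) g +
      (k + 1) • ∑ q, c r q • (contraction K c ^ k) (pderiv q g) := by
  induction k with
  | zero => simp [contraction_X_mul hc]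
  | succ k ih =>
    rw [pow_succ', Module.End.mul_apply, ih, map_add, contraction_X_mul hc, map_nsmul, map_sum,
      ← Module.End.mul_apply, ← pow_succ', add_assoc, succ_nsmul _ (k + 1),
      add_comm (∑ q, c r q • pderiv q ((contraction K c ^ (k + 1)) g))]
    simp only [map_smul, ← contraction_pow_pderiv, ← Module.End.mul_apply, ← pow_succ']

theorem contraction_pow_eq_zero (c : V → V → R) {k : ℕ} {g : MvPolynomial V R}
    (hg : g.totalDegree < k) : (contraction K c ^ k) g = 0 := by
  induction k generalizing g with
  | zero => exact absurd hg (Nat.not_lt_zero _)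
  | succ k ih =>
    rw [pow_succ, Module.End.mul_apply]
    rcases Nat.eq_zero_or_pos g.totalDegree with h0 | hpos
    · rw [totalDegree_eq_zero_iff_eq_C.1 h0, contraction_apply]
      simp
    · refine ih (lt_of_le_of_lt (b := g.totalDegree - 1) ?_ (by omega))
      rw [contraction_apply]
      refine (totalDegree_smul_le _ _).trans (totalDegree_finsetSum_le fun p _ =>
        totalDegree_finsetSum_le fun q _ => (totalDegree_smul_le _ _).trans ?_)
      have hp := totalDegree_pderiv_le p (pderiv q g)
      have hq := totalDegree_pderiv_le q g
      omega

/-- The term of order `k` in the exponential series which defines `wick c`. -/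
def wickTerm (c : V → V → R) (k : ℕ) : MvPolynomial V K →ₗ[K] R where
  toFun g := (k.factorial : K)⁻¹ •
    constantCoeff ((contraction K c ^ k) (map (algebraMap K R) g))
  map_add' g h := by simp only [map_add, smul_add]
  map_smul' a g := by
    have hmap : map (algebraMap K R) (a • g) = algebraMap K R a • map (algebraMap K R) g := by
      rw [smul_eq_C_mul, map_mul, map_C, smul_eq_C_mul]
    rw [hmap, LinearMap.map_smul, constantCoeff_smul, smul_eq_mul, ← Algebra.smul_def, smul_comm,
      RingHom.id_apply]

theorem wickTerm_apply (c : V → V → R) (k : ℕ) (g : MvPolynomial V K) :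
    wickTerm c k g = (k.factorial : K)⁻¹ •
      constantCoeff ((contraction K c ^ k) (map (algebraMap K R) g)) :=
  rfl

theorem wickTerm_eq_zero (c : V → V → R) {k : ℕ} {g : MvPolynomial V K} (hg : g.totalDegree < k) :
    wickTerm c k g = 0 := by
  have hmap : (map (algebraMap K R) g).totalDegree ≤ g.totalDegree :=
    Finset.sup_mono (support_map_subset _ _)
  rw [wickTerm_apply, contraction_pow_eq_zero c (hmap.trans_lt hg), map_zero, smul_zero]

theorem wickTerm_zero_X_mul (c : V → V → R) (p : V) (g : MvPolynomial V K) :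
    wickTerm c 0 (X p * g) = 0 := by
  simp [wickTerm_apply]

theorem wickTerm_succ_X_mul [CharZero K] {c : V → V → R} (hc : ∀ p q, c p q = c q p) (p : V)
    (g : MvPolynomial V K) (k : ℕ) :
    wickTerm c (k + 1) (X p * g) = ∑ q, c p q * wickTerm c k (pderiv q g) := by
  have hk : ((k + 1).factorial : K)⁻¹ * (k + 1 : ℕ) = (k.factorial : K)⁻¹ := by
    rw [Nat.factorial_succ, Nat.cast_mul, mul_inv_rev, mul_assoc,
      inv_mul_cancel₀ (Nat.cast_ne_zero.2 k.succ_ne_zero), mul_one]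
  simp only [wickTerm_apply, map_mul, map_X, contraction_pow_succ_X_mul hc, map_add, zero_mul,
    constantCoeff_X, zero_add, map_nsmul, map_sum, constantCoeff_smul, pderiv_map]
  rw [← Nat.cast_smul_eq_nsmul K, smul_smul, hk, Finset.smul_sum]
  simp only [smul_eq_mul, mul_smul_comm]

theorem sum_wickTerm_eq (c : V → V → R) {m : ℕ} {g : MvPolynomial V K} (hm : g.totalDegree < m) :
    ∑ k ∈ Finset.range (g.totalDegree + 1), wickTerm c k g =
      ∑ k ∈ Finset.range m, wickTerm c k g :=
  Finset.sum_subset (Finset.range_subset_range.2 hm) fun _ _ hk =>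
    wickTerm_eq_zero c (by simpa using hk)

/-- The expectation functional of a centred Gaussian family with covariances `c`: the constant
coefficient of `exp (½ ∑ p, ∑ q, c p q ∂²/∂z p ∂z q) g`. The covariances may lie in any algebra `R`
over the field of coefficients, so that they can be indeterminates. -/
def wick (c : V → V → R) : MvPolynomial V K →ₗ[K] R where
  toFun g := ∑ k ∈ Finset.range (g.totalDegree + 1), wickTerm c k g
  map_add' g h := by
    have hgh := Nat.lt_succ_of_le (totalDegree_add g h)
    rw [sum_wickTerm_eq c hgh, sum_wickTerm_eq c (Nat.lt_succ_of_le (le_max_left _ _)),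
      sum_wickTerm_eq c (Nat.lt_succ_of_le (le_max_right _ _)), ← Finset.sum_add_distrib]
    simp only [map_add]
  map_smul' a g := by
    rw [sum_wickTerm_eq c (Nat.lt_succ_of_le (totalDegree_smul_le a g)), RingHom.id_apply,
      Finset.smul_sum]
    simp only [map_smul]

theorem wick_eq_sum (c : V → V → R) {m : ℕ} {g : MvPolynomial V K} (hm : g.totalDegree < m) :
    wick c g = ∑ k ∈ Finset.range m, wickTerm c k g :=
  sum_wickTerm_eq c hm

@[simp]
theorem wick_one (c : V → V → R) : wick c (1 : MvPolynomial V K) = 1 := by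
  simp [wick_eq_sum c (m := 1), wickTerm_apply]

theorem wick_X_mul [CharZero K] {c : V → V → R} (hc : ∀ p q, c p q = c q p) (p : V)
    (g : MvPolynomial V K) : wick c (X p * g) = ∑ q, c p q * wick c (pderiv q g) := by
  have hX : (X p * g).totalDegree < g.totalDegree + 2 := by
    have := totalDegree_mul (X p) g
    rw [totalDegree_X] at this
    omega
  have hpderiv : ∀ q, (pderiv q g).totalDegree < g.totalDegree + 1 := fun q => by
    have := totalDegree_pderiv_le q g
    omega
  rw [wick_eq_sum c hX, Finset.sum_range_succ', wickTerm_zero_X_mul, add_zero]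
  simp only [wickTerm_succ_X_mul hc, wick_eq_sum c (hpderiv _), Finset.mul_sum]
  exact Finset.sum_comm

theorem eq_zero_of_wick_recursion {A : Set V} (c : V → V → R) (T : MvPolynomial V K →ₗ[K] R)
    (h1 : T 1 = 0)
    (hT : ∀ p ∈ A, ∀ g ∈ supported K A, T (X p * g) = ∑ q, c p q * T (pderiv q g))
    {g : MvPolynomial V K} (hg : g ∈ supported K A) : T g = 0 := by
  classical
  have hmonomial : ∀ (d : ℕ) (ν : V →₀ ℕ) (a : K), ν.degree = d → (ν.support : Set V) ⊆ A →
      T (monomial ν a) = 0 := by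
    intro d
    induction d using Nat.strong_induction_on with
    | _ d ih =>
      intro ν a hd hν
      rcases eq_or_ne ν 0 with rfl | h0
      · rw [← mul_one a, ← smul_eq_mul, ← smul_monomial, map_smul]
        exact (congrArg (a • ·) h1).trans (smul_zero a)
      obtain ⟨p, hp⟩ := Finsupp.support_nonempty_iff.2 h0
      obtain ⟨μ, rfl⟩ : ∃ μ, ν = Finsupp.single p 1 + μ := exists_add_of_le <|
        Finsupp.single_le_iff.2 (Nat.one_le_iff_ne_zero.2 (Finsupp.mem_support_iff.1 hp))
      have hμ : (μ.support : Set V) ⊆ A := fun x hx =>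
        hν (Finsupp.support_mono le_add_self hx)
      have hmem : (monomial μ a : MvPolynomial V K) ∈ supported K A := by
        refine mem_supported.2 fun x hx => hμ ?_
        obtain ⟨ν, hν, hx⟩ := (mem_vars_iff_mem_support x).1 hx
        rwa [Finset.mem_singleton.1 (support_monomial_subset hν)] at hx
      have hX : monomial (Finsupp.single p 1 + μ) a = X p * monomial μ a := by
        rw [X, monomial_mul, one_mul]
      rw [map_add, Finsupp.degree_single] at hd
      rw [hX, hT p (hν hp) _ hmem]
      refine Finset.sum_eq_zero fun q _ => ?_
      have hle : (μ - Finsupp.single q 1).degree ≤ μ.degree := Finsupp.degree_mono tsub_le_self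
      rw [pderiv_monomial, ih _ (by omega) _ _ rfl fun x hx => hμ (Finsupp.support_tsub hx),
        mul_zero]
  rw [← support_sum_monomial_coeff g, map_sum]
  exact Finset.sum_eq_zero fun ν hν => hmonomial _ ν _ rfl fun x hx =>
    mem_supported.1 hg ((mem_vars_iff_mem_support x).2 ⟨ν, hν, hx⟩)

theorem linearMap_eq_wick [CharZero K] {c : V → V → R} (hc : ∀ p q, c p q = c q p)
    (T : MvPolynomial V K →ₗ[K] R) (h1 : T 1 = 1)
    (hT : ∀ p g, T (X p * g) = ∑ q, c p q * T (pderiv q g)) : T = wick c := by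
  rw [← sub_eq_zero]
  refine LinearMap.ext fun g => ?_
  refine eq_zero_of_wick_recursion (A := Set.univ) c _ (by simp [h1]) (fun p _ g _ => ?_)
    (by simp)
  simp only [LinearMap.sub_apply, hT, wick_X_mul hc, mul_sub, Finset.sum_sub_distrib]

theorem wick_mul_of_uncorrelated [CharZero K] {c : V → V → R} (hc : ∀ p q, c p q = c q p)
    {A B : Set V} (hAB : ∀ p ∈ A, ∀ q ∈ B, c p q = 0) {g h : MvPolynomial V K}
    (hg : g ∈ supported K A) (hh : h ∈ supported K B) : wick c (g * h) = wick c g * wick c h := by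
  rw [← sub_eq_zero]
  let T : MvPolynomial V K →ₗ[K] R := wick c ∘ₗ LinearMap.mulRight K h -
    LinearMap.mulRight K (wick c h) ∘ₗ wick c
  refine eq_zero_of_wick_recursion (A := A) c T (by simp [T]) (fun p hp g _ => ?_) hg
  have hcross : ∑ q, c p q * wick c (g * pderiv q h) = 0 := Finset.sum_eq_zero fun q _ => by
    by_cases hq : q ∈ B
    · rw [hAB p hp q hq, zero_mul]
    · rw [pderiv_eq_zero_of_mem_supported hh hq, mul_zero, map_zero, mul_zero]
  simp only [T, LinearMap.sub_apply, LinearMap.comp_apply, LinearMap.mulRight_apply, mul_assoc,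
    wick_X_mul hc, pderiv_mul, map_add, mul_add, mul_sub, Finset.sum_add_distrib,
    Finset.sum_sub_distrib, Finset.sum_mul, hcross, add_zero]

theorem wick_prod_of_uncorrelated [CharZero K] {ι : Type*} {c : V → V → R}
    (hc : ∀ p q, c p q = c q p) {A : ι → Set V}
    (hA : ∀ i j, i ≠ j → ∀ p ∈ A i, ∀ q ∈ A j, c p q = 0) {g : ι → MvPolynomial V K}
    (hg : ∀ i, g i ∈ supported K (A i)) (s : Finset ι) :
    wick c (∏ i ∈ s, g i) = ∏ i ∈ s, wick c (g i) := by
  classical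
  induction s using Finset.induction_on with
  | empty => simp
  | insert i s hi ih =>
    rw [Finset.prod_insert hi, Finset.prod_insert hi, ← ih]
    refine wick_mul_of_uncorrelated hc (A := A i) (B := ⋃ j ∈ s, A j) (fun p hp q hq => ?_) (hg i)
      (prod_mem fun j hj => supported_mono (Set.subset_biUnion_of_mem (u := A) hj) (hg j))
    obtain ⟨j, hj, hq⟩ := Set.mem_iUnion₂.1 hq
    exact hA i j (fun h => hi (h ▸ hj)) p hp q hq

theorem wick_congr_of_mem_supported [CharZero K] {c c' : V → V → R} (hc : ∀ p q, c p q = c q p)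
    (hc' : ∀ p q, c' p q = c' q p) {A : Set V} (h : ∀ p ∈ A, ∀ q ∈ A, c p q = c' p q)
    {g : MvPolynomial V K} (hg : g ∈ supported K A) : wick c g = wick c' g := by
  rw [← sub_eq_zero]
  refine eq_zero_of_wick_recursion (A := A) c (wick c - wick c') (by simp)
    (fun p hp g hg => ?_) hg
  have hrow : ∑ q, c' p q * wick c' (pderiv q g) = ∑ q, c p q * wick c' (pderiv q g) :=
    Finset.sum_congr rfl fun q _ => by
      by_cases hq : q ∈ A
      · rw [h p hp q hq]
      · rw [pderiv_eq_zero_of_mem_supported hg hq, map_zero, mul_zero, mul_zero]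
  simp only [LinearMap.sub_apply, wick_X_mul hc, wick_X_mul hc', hrow, mul_sub,
    Finset.sum_sub_distrib]

theorem algHom_wick [CharZero K] {R' : Type*} [CommRing R'] [Algebra K R'] (φ : R →ₐ[K] R')
    {c : V → V → R} (hc : ∀ p q, c p q = c q p) (g : MvPolynomial V K) :
    φ (wick c g) = wick (fun p q => φ (c p q)) g :=
  LinearMap.congr_fun (linearMap_eq_wick (c := fun p q => φ (c p q)) (fun p q => by rw [hc])
    (φ.toLinearMap ∘ₗ wick c) (by simp) fun p g => by simp [wick_X_mul hc]) g

end Wick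

/-! ### Moments and laws of Gaussian families -/

section Gaussian

open MvPolynomial

section PowersOfLinearForms

variable {K S : Type*} [Field K] [Fintype S]

theorem linear_pow_eq_sum_monomial [DecidableEq S] (u : S → K) (m : ℕ) :
    (∑ s, C (u s) * X s : MvPolynomial S K) ^ m =
      ∑ k ∈ Finset.piAntidiag Finset.univ m, ((Nat.multinomial Finset.univ k : K) *
        ∏ s, u s ^ k s) • monomial (Finsupp.equivFunOnFinite.symm k) 1 := by
  rw [Finset.sum_pow_eq_sum_piAntidiag]
  refine Finset.sum_congr rfl fun k _ => ?_
  rw [monomial_eq, Finsupp.prod_fintype _ _ fun _ => pow_zero _]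
  simp [mul_pow, Finset.prod_mul_distrib, smul_eq_C_mul, mul_assoc]

theorem wick_linear_pow_succ [CharZero K] {c : S → S → K} (hc : ∀ p q, c p q = c q p)
    (u : S → K) (m : ℕ) :
    wick c ((∑ s, C (u s) * X s) ^ (m + 1)) =
      m * (∑ p, ∑ q, u p * u q * c p q) * wick c ((∑ s, C (u s) * X s) ^ (m - 1)) := by
  classical
  set l : MvPolynomial S K := ∑ s, C (u s) * X s with hl
  have hpderiv : ∀ q, pderiv q (l ^ m) = (m * u q) • l ^ (m - 1) := by
    intro q
    have hlq : pderiv q l = C (u q) := by simp [hl, pderiv_X, Pi.single_apply]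
    rw [pderiv_pow, hlq, smul_eq_C_mul, map_mul, map_natCast]
    ring
  have hexpand : l ^ (m + 1) = ∑ p, u p • (X p * l ^ m) := by
    rw [pow_succ', hl, Finset.sum_mul]
    simp only [smul_eq_C_mul, mul_assoc]
  simp only [hexpand, map_sum, map_smul, wick_X_mul hc, hpderiv, smul_eq_mul, Finset.mul_sum,
    Finset.sum_mul]
  exact Finset.sum_congr rfl fun p _ => Finset.sum_congr rfl fun q _ => by ring

theorem eq_zero_of_forall_linear_pow [CharZero K] (T : MvPolynomial S K →ₗ[K] K)
    (h : ∀ (u : S → K) (m : ℕ), T ((∑ s, C (u s) * X s) ^ m) = 0) : T = 0 := by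
  classical
  refine (basisMonomials S K).ext fun ν => ?_
  rw [coe_basisMonomials, LinearMap.zero_apply]
  set m := ∑ s, ν s with hm
  -- `u ↦ T ((∑ s, u s * X s) ^ m)` is a polynomial function; its coefficients are, up to
  -- multinomial factors, the values of `T` on the monomials of degree `m`.
  let B : MvPolynomial S K := ∑ k ∈ Finset.piAntidiag Finset.univ m,
    monomial (Finsupp.equivFunOnFinite.symm k)
      ((Nat.multinomial Finset.univ k : K) * T (monomial (Finsupp.equivFunOnFinite.symm k) 1))
  have hB : B = 0 := MvPolynomial.funext fun u => by
    rw [map_zero, ← h u m, linear_pow_eq_sum_monomial, map_sum, map_sum]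
    refine Finset.sum_congr rfl fun k _ => ?_
    rw [map_smul, eval_monomial, Finsupp.prod_fintype _ _ fun _ => pow_zero _, smul_eq_mul,
      mul_right_comm]
    rfl
  have hcoeff : coeff ν B = (Nat.multinomial Finset.univ ν : K) * T (monomial ν 1) := by
    rw [coeff_sum, Finset.sum_eq_single (ν : S → ℕ)]
    · simp
    · exact fun k _ hk => by
        rw [coeff_monomial, if_neg fun hν => hk (congrArg DFunLike.coe hν)]
    · exact fun hν => absurd (by simp [hm]) hν
  rw [hB, coeff_zero] at hcoeff
  exact (mul_eq_zero.1 hcoeff.symm).resolve_left (Nat.cast_ne_zero.2 (Nat.multinomial_pos _ _).ne')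

end PowersOfLinearForms

theorem integral_pow_succ_gaussianReal (v : NNReal) (m : ℕ) :
    ∫ x, x ^ (m + 1) ∂gaussianReal 0 v = m * v * ∫ x, x ^ (m - 1) ∂gaussianReal 0 v := by
  rcases eq_or_ne v 0 with rfl | hv
  · simp [gaussianReal_zero_var]
  have hv' : (v : ℝ) ≠ 0 := NNReal.coe_ne_zero.2 hv
  have hintegral : ∀ k : ℕ,
      ∫ x, x ^ k ∂gaussianReal 0 v = ∫ x, x ^ k * gaussianPDFReal 0 v x := fun k => by
    simp [integral_gaussianReal_eq_integral_smul hv, mul_comm]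
  have hintegrable : ∀ k : ℕ, Integrable fun x : ℝ => x ^ k * gaussianPDFReal 0 v x := by
    intro k
    have h : Integrable (fun x : ℝ => x ^ k) (gaussianReal 0 v) := by
      rw [← integrable_norm_iff (by fun_prop)]
      simpa only [norm_pow, id] using (memLp_id_gaussianReal (k : NNReal)).integrable_norm_pow'
    rw [gaussianReal_of_var_ne_zero _ hv, integrable_withDensity_iff_integrable_smul'
      (measurable_gaussianPDF _ _) (ae_of_all _ fun _ => gaussianPDF_lt_top)] at h
    simpa only [toReal_gaussianPDF, smul_eq_mul, mul_comm] using h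
  have hderiv : ∀ x, HasDerivAt (fun x => x ^ m * gaussianPDFReal 0 v x)
      (m * (x ^ (m - 1) * gaussianPDFReal 0 v x) -
        (v : ℝ)⁻¹ * (x ^ (m + 1) * gaussianPDFReal 0 v x)) x := by
    intro x
    have hpdf : HasDerivAt (gaussianPDFReal 0 v) (-((v : ℝ)⁻¹ * x) * gaussianPDFReal 0 v x) x := by
      have hexp := ((((hasDerivAt_pow 2 x).fun_neg.div_const (2 * (v : ℝ))).exp).const_mul
        (√(2 * Real.pi * v))⁻¹)
      simp only [gaussianPDFReal_def, sub_zero]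
      refine hexp.congr_deriv ?_
      field_simp
      ring
    refine ((hasDerivAt_pow m x).mul hpdf).congr_deriv ?_
    ring
  have hparts := integral_eq_zero_of_hasDerivAt_of_integrable hderiv
    (((hintegrable _).const_mul _).sub ((hintegrable _).const_mul _)) (hintegrable m)
  rw [integral_sub ((hintegrable _).const_mul _) ((hintegrable _).const_mul _),
    integral_const_mul, integral_const_mul, ← hintegral, ← hintegral, sub_eq_zero] at hparts
  field_simp at hparts
  linarith

section SecondMoments

variable {Ω S : Type*} [MeasurableSpace Ω]

/-- The matrix of mixed second moments of a family of random variables, which for a centred family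
is its covariance matrix. -/
def secondMoment (P : Measure Ω) (ζ : S → Ω → ℝ) (p q : S) : ℝ :=
  ∫ ω, ζ p ω * ζ q ω ∂P

theorem secondMoment_comm (P : Measure Ω) (ζ : S → Ω → ℝ) (p q : S) :
    secondMoment P ζ p q = secondMoment P ζ q p := by
  simp only [secondMoment, mul_comm]

theorem integral_sum_mul_sq [Fintype S] {P : Measure Ω} {ζ : S → Ω → ℝ}
    (hζ : ∀ p q, Integrable (fun ω => ζ p ω * ζ q ω) P) (u : S → ℝ) :
    ∫ ω, (∑ s, u s * ζ s ω) ^ 2 ∂P = ∑ p, ∑ q, u p * u q * secondMoment P ζ p q := by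
  have hsq : ∀ ω, (∑ s, u s * ζ s ω) ^ 2 = ∑ p, ∑ q, u p * u q * (ζ p ω * ζ q ω) := fun ω => by
    simp only [sq, Finset.sum_mul_sum, mul_mul_mul_comm]
  simp only [hsq, secondMoment]
  rw [integral_finsetSum _ fun p _ => integrable_finsetSum _ fun q _ => (hζ p q).const_mul _]
  refine Finset.sum_congr rfl fun p _ => ?_
  rw [integral_finsetSum _ fun q _ => (hζ p q).const_mul _]
  simp only [integral_const_mul]

theorem posSemidef_secondMoment [Finite S] {P : Measure Ω} {ζ : S → Ω → ℝ}
    (hζ : ∀ p q, Integrable (fun ω => ζ p ω * ζ q ω) P) :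
    (Matrix.of (secondMoment P ζ)).PosSemidef := by
  have := Fintype.ofFinite S
  refine Matrix.posSemidef_iff_dotProduct_mulVec.2
    ⟨Matrix.ext fun p q => secondMoment_comm P ζ q p, fun u => ?_⟩
  have hquad : star u ⬝ᵥ (Matrix.of (secondMoment P ζ)).mulVec u =
      ∫ ω, (∑ s, u s * ζ s ω) ^ 2 ∂P := by
    simp only [integral_sum_mul_sq hζ, dotProduct, Matrix.mulVec, Matrix.of_apply, star_trivial,
      Finset.mul_sum]
    exact Finset.sum_congr rfl fun p _ => Finset.sum_congr rfl fun q _ => by ring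
  rw [hquad]
  exact integral_nonneg fun ω => sq_nonneg _

end SecondMoments

namespace IsCentredGaussian

variable {Ω S : Type*} [MeasurableSpace Ω] [Fintype S] {P : Measure Ω} {ζ : S → Ω → ℝ}

theorem memLp_eval (h : IsCentredGaussian P ζ) (g : MvPolynomial S ℝ) {r : ENNReal} (hr : r ≠ ⊤) :
    MemLp (fun ω => eval (fun s => ζ s ω) g) r P := by
  have := h.gaussian.isProbabilityMeasure
  induction g using MvPolynomial.induction_on generalizing r with
  | C a => simpa only [eval_C] using memLp_const a
  | add f g hf hg =>
    simp only [map_add]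
    exact (hf hr).add (hg hr)
  | mul_X g s hg =>
    have h2r : 2 * r ≠ ⊤ := ENNReal.mul_ne_top ENNReal.ofNat_ne_top hr
    have : ENNReal.HolderTriple (2 * r) (2 * r) r := ⟨by
      rw [ENNReal.mul_inv (by simp) (by simp), ← add_mul, ENNReal.inv_two_add_inv_two, one_mul]⟩
    simpa only [map_mul, eval_X] using ((h.gaussian.eval s).memLp h2r).mul' (hg h2r)

theorem integrable_eval (h : IsCentredGaussian P ζ) (g : MvPolynomial S ℝ) :
    Integrable (fun ω => eval (fun s => ζ s ω) g) P :=
  memLp_one_iff_integrable.1 (h.memLp_eval g ENNReal.one_ne_top)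

theorem integrable_mul (h : IsCentredGaussian P ζ) (p q : S) :
    Integrable (fun ω => ζ p ω * ζ q ω) P := by
  have hpq := h.integrable_eval (X p * X q)
  simp only [map_mul, eval_X] at hpq
  exact hpq

/-- The expectation of a polynomial in the family, as a linear functional. -/
def expectation (h : IsCentredGaussian P ζ) : MvPolynomial S ℝ →ₗ[ℝ] ℝ where
  toFun g := ∫ ω, eval (fun s => ζ s ω) g ∂P
  map_add' f g := by
    simpa only [map_add] using integral_add (h.integrable_eval f) (h.integrable_eval g)
  map_smul' a g := by
    simpa only [smul_eval, smul_eq_mul, RingHom.id_apply] using integral_const_mul a _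

theorem expectation_apply (h : IsCentredGaussian P ζ) (g : MvPolynomial S ℝ) :
    h.expectation g = ∫ ω, eval (fun s => ζ s ω) g ∂P :=
  rfl

theorem map_sum_mul_eq_gaussianReal (h : IsCentredGaussian P ζ) (u : S → ℝ) :
    P.map (fun ω => ∑ s, u s * ζ s ω) =
      gaussianReal 0 (∑ p, ∑ q, u p * u q * secondMoment P ζ p q).toNNReal := by
  have hgaussian : HasGaussianLaw (fun ω => ∑ s, u s * ζ s ω) P := by
    let L : (S → ℝ) →L[ℝ] ℝ := ∑ s, u s • ContinuousLinearMap.proj s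
    exact (h.gaussian.map_fun L).congr (ae_of_all _ fun ω => by simp [L])
  have hmean : ∫ ω, ∑ s, u s * ζ s ω ∂P = 0 := by
    rw [integral_finsetSum _ fun s _ => (h.gaussian.eval s).integrable.const_mul _]
    exact Finset.sum_eq_zero fun s _ => by rw [integral_const_mul, h.mean_zero, mul_zero]
  rw [hgaussian.map_eq_gaussianReal, variance_of_integral_eq_zero hgaussian.aemeasurable hmean,
    hmean, integral_sum_mul_sq h.integrable_mul]

theorem integral_sum_mul_pow (h : IsCentredGaussian P ζ) (u : S → ℝ) (m : ℕ) :
    ∫ ω, (∑ s, u s * ζ s ω) ^ m ∂P = wick (secondMoment P ζ) ((∑ s, C (u s) * X s) ^ m) := by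
  have hnonneg : 0 ≤ ∑ p, ∑ q, u p * u q * secondMoment P ζ p q := by
    rw [← integral_sum_mul_sq h.integrable_mul]
    exact integral_nonneg fun ω => sq_nonneg _
  set v := ∑ p, ∑ q, u p * u q * secondMoment P ζ p q
  have hmoment (k : ℕ) :
      ∫ ω, (∑ s, u s * ζ s ω) ^ k ∂P = ∫ x, x ^ k ∂gaussianReal 0 v.toNNReal := by
    have haemeasurable : AEMeasurable (fun ω => ∑ s, u s * ζ s ω) P :=
      Finset.aemeasurable_fun_sum _ fun s _ => (h.gaussian.eval s).aemeasurable.const_mul _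
    rw [← h.map_sum_mul_eq_gaussianReal, integral_map haemeasurable (by fun_prop)]
  induction m using Nat.strong_induction_on with
  | _ m ih =>
    cases m with
    | zero => simp [h.gaussian.isProbabilityMeasure]
    | succ m =>
      rw [wick_linear_pow_succ (secondMoment_comm P ζ), ← ih (m - 1) (by omega), hmoment, hmoment,
        integral_pow_succ_gaussianReal, Real.coe_toNNReal _ hnonneg]

theorem integral_eval (h : IsCentredGaussian P ζ) (g : MvPolynomial S ℝ) :
    ∫ ω, eval (fun s => ζ s ω) g ∂P = wick (secondMoment P ζ) g := by
  suffices hT : h.expectation - wick (secondMoment P ζ) = 0 from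
    sub_eq_zero.1 (LinearMap.congr_fun hT g)
  refine eq_zero_of_forall_linear_pow _ fun u m => ?_
  rw [LinearMap.sub_apply, sub_eq_zero, ← h.integral_sum_mul_pow, expectation_apply]
  simp

/-- By the Cramér–Wold device. -/
theorem law_unique {ν ν' : Measure (S → ℝ)} (h : IsCentredGaussian ν fun s x => x s)
    (h' : IsCentredGaussian ν' fun s x => x s)
    (hcov : secondMoment ν (fun s x => x s) = secondMoment ν' fun s x => x s) : ν = ν' := by
  classical
  have := h.gaussian.isProbabilityMeasure
  have := h'.gaussian.isProbabilityMeasure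
  refine Measure.ext_of_charFunDual (funext fun L => ?_)
  have hL : ∀ x, L x = ∑ s, L (Pi.single s 1) * x s := fun x => by
    conv_lhs => rw [pi_eq_sum_univ' x, map_sum]
    simp only [map_smul, smul_eq_mul, mul_comm]
  rw [charFunDual_eq_charFun_map_one, charFunDual_eq_charFun_map_one, funext hL,
    h.map_sum_mul_eq_gaussianReal, h'.map_sum_mul_eq_gaussianReal, hcov]

end IsCentredGaussian

theorem exists_isCentredGaussian {S : Type*} [Fintype S] {C : Matrix S S ℝ} (hC : C.PosSemidef) :
    ∃ ν : Measure (S → ℝ), IsCentredGaussian ν (fun s x => x s) ∧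
      secondMoment ν (fun s x => x s) = C := by
  classical
  let μ := multivariateGaussian (0 : EuclideanSpace ℝ S) C
  let L := PiLp.continuousLinearEquiv 2 ℝ fun _ : S => ℝ
  have hL : AEMeasurable L μ := L.continuous.aemeasurable
  have hmean : ∀ s, ∫ x, x s ∂μ = 0 := fun s => by
    simpa [μ] using (EuclideanSpace.proj (𝕜 := ℝ) s).integral_comp_id_comm
      (IsGaussian.integrable_id (μ := μ))
  have hmemLp : ∀ s, MemLp (fun x : EuclideanSpace ℝ S => x s) 2 μ := fun s =>
    IsGaussian.memLp_dual μ (EuclideanSpace.proj (𝕜 := ℝ) s) 2 (by simp)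
  refine ⟨μ.map L, ⟨IsGaussian.hasGaussianLaw_id, fun s => ?_⟩, funext fun p => funext fun q => ?_⟩
  · rw [integral_map hL (measurable_pi_apply s).aestronglyMeasurable]
    exact hmean s
  · have hcov := covariance_eval_multivariateGaussian (μ := 0) hC p q
    rw [covariance_eq_sub (hmemLp p) (hmemLp q), hmean p, zero_mul, sub_zero] at hcov
    rw [← hcov, secondMoment, integral_map hL (by fun_prop)]
    rfl

theorem existsUnique_recoupling {n N : ℕ} {Ω : Type*} [MeasurableSpace Ω] {P : Measure Ω}
    {ζ : Var n N → Ω → ℝ} (hζ : IsCentredGaussian P ζ) {Q : Matrix (Fin n) (Fin n) ℝ}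
    (hQ : Q.PosSemidef) :
    ∃! ν : Measure (Var n N → ℝ), IsRecoupling P ζ Q ν fun p x => x p := by
  obtain ⟨ν, hν, hcov⟩ := exists_isCentredGaussian
    ((hQ.submatrix Prod.fst).hadamard (posSemidef_secondMoment hζ.integrable_mul))
  have hrec : IsRecoupling P ζ Q ν fun p x => x p := ⟨hν, fun p q => congrFun₂ hcov p q⟩
  refine ⟨ν, hrec, fun ν' hν' => hν'.centred.law_unique hν (funext₂ fun p q => ?_)⟩
  exact (hν'.covariance p q).trans (hrec.covariance p q).symm

end Gaussian

/-! ### Partitions and bonds -/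

section Partition

variable {α : Type*} [Fintype α] [DecidableEq α]

/-- The relation of lying in a common block of a partition. -/
def SameBlock (Ψ : Finpartition (Finset.univ : Finset α)) (i j : α) : Prop :=
  ∃ A ∈ Ψ.parts, i ∈ A ∧ j ∈ A

variable {Θ Ψ : Finpartition (Finset.univ : Finset α)} {i j k : α}

theorem sameBlock_iff_part_eq : SameBlock Ψ i j ↔ Ψ.part i = Ψ.part j := by
  rw [SameBlock, ← Ψ.mem_part_iff_exists,
    Ψ.mem_part_iff_part_eq_part (Finset.mem_univ _) (Finset.mem_univ _)]

theorem SameBlock.refl (Ψ : Finpartition (Finset.univ : Finset α)) (i : α) : SameBlock Ψ i i :=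
  sameBlock_iff_part_eq.2 rfl

theorem SameBlock.symm (h : SameBlock Ψ i j) : SameBlock Ψ j i :=
  sameBlock_iff_part_eq.2 (sameBlock_iff_part_eq.1 h).symm

theorem SameBlock.trans (h : SameBlock Ψ i j) (h' : SameBlock Ψ j k) : SameBlock Ψ i k :=
  sameBlock_iff_part_eq.2 ((sameBlock_iff_part_eq.1 h).trans (sameBlock_iff_part_eq.1 h'))

theorem le_iff_sameBlock : Θ ≤ Ψ ↔ ∀ i j, SameBlock Θ i j → SameBlock Ψ i j := by
  constructor
  · rintro h i j ⟨A, hA, hi, hj⟩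
    obtain ⟨B, hB, hAB⟩ := h hA
    exact ⟨B, hB, hAB hi, hAB hj⟩
  · intro h A hA
    obtain ⟨i, hi⟩ := Θ.nonempty_of_mem_parts hA
    exact ⟨Ψ.part i, Ψ.part_mem.2 (Finset.mem_univ _), fun j hj =>
      Ψ.mem_part_iff_exists.2 (h j i ⟨A, hA, hj, hi⟩)⟩

theorem SameBlock.mono (h : SameBlock Θ i j) (hle : Θ ≤ Ψ) : SameBlock Ψ i j :=
  le_iff_sameBlock.1 hle i j h

theorem card_parts_top_le_one : (⊤ : Finpartition (Finset.univ : Finset α)).parts.card ≤ 1 := by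
  simpa using Finset.card_le_card (Finpartition.parts_top_subset (Finset.univ : Finset α))

theorem sameBlock_of_card_parts_le_one (h : Ψ.parts.card ≤ 1) (i j : α) : SameBlock Ψ i j :=
  sameBlock_iff_part_eq.2 <| Finset.card_le_one.1 h _ (Ψ.part_mem.2 (Finset.mem_univ _)) _
    (Ψ.part_mem.2 (Finset.mem_univ _))

theorem eq_top_of_card_parts_le_one (h : Θ.parts.card ≤ 1) : Θ = ⊤ :=
  top_le_iff.1 <| le_iff_sameBlock.2 fun i j _ => sameBlock_of_card_parts_le_one h i j

theorem sameBlock_top (i j : α) : SameBlock (⊤ : Finpartition (Finset.univ : Finset α)) i j :=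
  sameBlock_of_card_parts_le_one card_parts_top_le_one i j

theorem sameBlock_inf : SameBlock (Θ ⊓ Ψ) i j ↔ SameBlock Θ i j ∧ SameBlock Ψ i j := by
  refine ⟨fun h => ⟨h.mono inf_le_left, h.mono inf_le_right⟩, ?_⟩
  rintro ⟨⟨A, hA, hiA, hjA⟩, B, hB, hiB, hjB⟩
  have hi : i ∈ A ∩ B := Finset.mem_inter.2 ⟨hiA, hiB⟩
  refine ⟨A ∩ B, ?_, hi, Finset.mem_inter.2 ⟨hjA, hjB⟩⟩
  rw [Finpartition.parts_inf, Finset.mem_erase]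
  exact ⟨Finset.ne_empty_of_mem hi, Finset.mem_image.2 ⟨(A, B), Finset.mem_product.2 ⟨hA, hB⟩, rfl⟩⟩

theorem sameBlock_finset_inf {s : Finset (Finpartition (Finset.univ : Finset α))} :
    SameBlock (s.inf id) i j ↔ ∀ Ψ ∈ s, SameBlock Ψ i j := by
  classical
  induction s using Finset.induction_on with
  | empty => simp [sameBlock_top]
  | insert Ψ s _ ih => rw [Finset.inf_insert, sameBlock_inf, ih, Finset.forall_mem_insert, id]

open scoped Classical in
/-- The partition into the nonempty fibres of a map, thought of as a colouring. -/
def fiberPartition {β : Type*} (c : α → β) : Finpartition (Finset.univ : Finset α) :=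
  Finpartition.ofSetoid (Setoid.ker c)

variable {β : Type*} {c : α → β}

theorem sameBlock_fiberPartition : SameBlock (fiberPartition c) i j ↔ c i = c j := by
  classical
  rw [SameBlock, ← Finpartition.mem_part_iff_exists, fiberPartition,
    Finpartition.mem_part_ofSetoid_iff_rel]
  exact eq_comm

theorem card_parts_fiberPartition [DecidableEq β] (c : α → β) :
    (fiberPartition c).parts.card = (Finset.univ.image c).card := by
  classical
  have hparts : (fiberPartition c).parts =
      (Finset.univ.image c).image fun y => Finset.univ.filter fun i => y = c i := by
    rw [Finset.image_image]
    ext A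
    simp [fiberPartition, Finpartition.ofSetoid, Finpartition.ofSetSetoid, Setoid.ker_def]
  rw [hparts, Finset.card_image_of_injOn]
  intro y hy y' _ h
  obtain ⟨i, -, rfl⟩ := Finset.mem_image.1 (Finset.mem_coe.1 hy)
  have hi : i ∈ Finset.univ.filter fun k => y' = c k :=
    (Finset.ext_iff.1 h i).1 (Finset.mem_filter.2 ⟨Finset.mem_univ i, rfl⟩)
  exact (Finset.mem_filter.1 hi).2.symm

/-- The relation, between a bond and a partition, of lying inside a block. -/
def InBlock (Ψ : Finpartition (Finset.univ : Finset α)) (e : Sym2 α) : Prop :=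
  ∃ B ∈ Ψ.parts, ∀ i ∈ e, i ∈ B

theorem inBlock_mk : InBlock Ψ s(i, j) ↔ SameBlock Ψ i j := by
  simp [InBlock, SameBlock]

theorem InBlock.mono {e : Sym2 α} (he : InBlock Θ e) (h : Θ ≤ Ψ) : InBlock Ψ e := by
  obtain ⟨A, hA, hA'⟩ := he
  obtain ⟨B, hB, hAB⟩ := h hA
  exact ⟨B, hB, fun i hi => hAB (hA' i hi)⟩

theorem inBlock_of_isDiag (Ψ : Finpartition (Finset.univ : Finset α)) {e : Sym2 α}
    (he : e.IsDiag) : InBlock Ψ e := by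
  induction e with | _ a b
  obtain rfl : a = b := he
  exact inBlock_mk.2 (SameBlock.refl Ψ a)

end Partition

section Join

variable {n : ℕ} {Γ : Finset (Sym2 (Fin n))} {Θ Ψ : SetPart n} {e : Sym2 (Fin n)}

theorem sameBlock_join {i j : Fin n} :
    SameBlock (join Γ Θ) i j ↔
      ∀ Ψ : SetPart n, Θ ≤ Ψ → (∀ e ∈ Γ, InBlock Ψ e) → SameBlock Ψ i j := by
  rw [join, sameBlock_finset_inf]
  simp only [Finset.mem_filter, Finset.mem_univ, true_and, and_imp]
  rfl

theorem le_join (Γ : Finset (Sym2 (Fin n))) (Θ : SetPart n) : Θ ≤ join Γ Θ :=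
  le_iff_sameBlock.2 fun _ _ hij => sameBlock_join.2 fun _ hΨ _ => hij.mono hΨ

theorem inBlock_join (Θ : SetPart n) (he : e ∈ Γ) : InBlock (join Γ Θ) e := by
  induction e with | _ a b
  exact inBlock_mk.2 (sameBlock_join.2 fun Ψ _ hΨ => inBlock_mk.1 (hΨ _ he))

theorem join_le_iff : join Γ Θ ≤ Ψ ↔ Θ ≤ Ψ ∧ ∀ e ∈ Γ, InBlock Ψ e := by
  refine ⟨fun h => ⟨(le_join Γ Θ).trans h, fun e he => (inBlock_join Θ he).mono h⟩, ?_⟩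
  rintro ⟨hle, hin⟩
  exact le_iff_sameBlock.2 fun i j hij => sameBlock_join.1 hij Ψ hle hin

@[simp]
theorem join_empty (Θ : SetPart n) : join ∅ Θ = Θ :=
  eq_of_forall_ge_iff fun Ψ => by simp [join_le_iff]

theorem join_insert (e : Sym2 (Fin n)) (Γ : Finset (Sym2 (Fin n))) (Θ : SetPart n) :
    join (insert e Γ) Θ = join Γ (join {e} Θ) :=
  eq_of_forall_ge_iff fun Ψ => by
    simp only [join_le_iff, Finset.forall_mem_insert, Finset.mem_singleton, forall_eq, and_assoc]

theorem join_singleton_of_inBlock (h : InBlock Θ e) : join {e} Θ = Θ :=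
  le_antisymm (join_le_iff.2 ⟨le_rfl, by simpa using h⟩) (le_join _ _)

theorem join_singleton_mk (Θ : SetPart n) (a b : Fin n) :
    join {s(a, b)} Θ = fiberPartition fun i =>
      if Θ.part i = Θ.part b then Θ.part a else Θ.part i := by
  set c : Fin n → Finset (Fin n) := fun i => if Θ.part i = Θ.part b then Θ.part a else Θ.part i
    with hc
  have hab : SameBlock (join {s(a, b)} Θ) a b :=
    inBlock_mk.1 (inBlock_join Θ (Finset.mem_singleton_self _))
  have h_part {i j : Fin n} (h : Θ.part i = Θ.part j) : SameBlock (join {s(a, b)} Θ) i j :=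
    (sameBlock_iff_part_eq.2 h).mono (le_join _ _)
  refine le_antisymm (join_le_iff.2 ⟨le_iff_sameBlock.2 fun i j hij => ?_, ?_⟩)
    (le_iff_sameBlock.2 fun i j hij => ?_)
  · simp only [sameBlock_fiberPartition, hc, sameBlock_iff_part_eq.1 hij]
  · simp only [Finset.mem_singleton, forall_eq, inBlock_mk, sameBlock_fiberPartition, hc, if_true,
      ite_self]
  · rw [sameBlock_fiberPartition] at hij
    simp only [hc] at hij
    split_ifs at hij with hi hj hj
    · exact h_part (hi.trans hj.symm)
    · exact ((h_part hi).trans hab.symm).trans (h_part hij)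
    · exact ((h_part hij).trans hab).trans (h_part hj.symm)
    · exact h_part hij

theorem card_parts_join_singleton (h : ¬ InBlock Θ e) :
    (join {e} Θ).parts.card + 1 = Θ.parts.card := by
  induction e with | _ a b
  rw [inBlock_mk, sameBlock_iff_part_eq] at h
  have himage : (Finset.univ.image fun i =>
      if Θ.part i = Θ.part b then Θ.part a else Θ.part i) = Θ.parts.erase (Θ.part b) := by
    ext B
    simp only [Finset.mem_image, Finset.mem_univ, true_and, Finset.mem_erase]
    constructor
    · rintro ⟨i, rfl⟩
      split_ifs with hi
      · exact ⟨h, Θ.part_mem.2 (Finset.mem_univ a)⟩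
      · exact ⟨hi, Θ.part_mem.2 (Finset.mem_univ i)⟩
    · rintro ⟨hB, hBΘ⟩
      obtain ⟨i, hi⟩ := Θ.nonempty_of_mem_parts hBΘ
      obtain rfl := Θ.part_eq_of_mem hBΘ hi
      exact ⟨i, if_neg hB⟩
  rw [join_singleton_mk, card_parts_fiberPartition, himage]
  exact Finset.card_erase_add_one (Θ.part_mem.2 (Finset.mem_univ b))

theorem card_parts_le_card_parts_join (Γ : Finset (Sym2 (Fin n))) (Θ : SetPart n) :
    Θ.parts.card ≤ (join Γ Θ).parts.card + Γ.card := by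
  induction Γ using Finset.induction_on generalizing Θ with
  | empty => simp
  | insert e Γ he ih =>
    rw [join_insert, Finset.card_insert_of_notMem he]
    have h_join := ih (join {e} Θ)
    by_cases h : InBlock Θ e
    · rw [join_singleton_of_inBlock h] at h_join ⊢
      omega
    · have := card_parts_join_singleton h
      omega

end Join

/-! ### Enumerations of trees -/

section JoinsUp

variable {n : ℕ}

/-- A sequence of bonds each of which joins two distinct blocks of the partition obtained from `Θ`
so far, and at whose end a single block is left. These are the enumerations of the trees on `Θ`,
in a form suited to induction. -/
def JoinsUp : {m : ℕ} → (Θ : SetPart n) → (Fin m → Sym2 (Fin n)) → Prop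
  | 0, Θ, _ => Θ = ⊤
  | _ + 1, Θ, e => ¬ InBlock Θ (e 0) ∧ JoinsUp (join {e 0} Θ) (Fin.tail e)

variable {m : ℕ} {Θ : SetPart n}

theorem JoinsUp.not_inBlock {e : Fin m → Sym2 (Fin n)} (h : JoinsUp Θ e) (α : Fin m) :
    ¬ InBlock Θ (e α) := by
  induction m generalizing Θ with
  | zero => exact α.elim0
  | succ m ih => exact Fin.cases h.1 (fun β hβ => ih h.2 β (hβ.mono (le_join _ _))) α

theorem JoinsUp.injective {e : Fin m → Sym2 (Fin n)} (h : JoinsUp Θ e) :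
    Function.Injective e := by
  induction m generalizing Θ with
  | zero => exact fun α => α.elim0
  | succ m ih =>
    rw [← Fin.cons_self_tail e, Fin.cons_injective_iff]
    refine ⟨?_, ih h.2⟩
    rintro ⟨β, hβ⟩
    exact h.2.not_inBlock β (hβ ▸ inBlock_join Θ (Finset.mem_singleton_self _))

theorem image_univ_succ {S : Type*} [DecidableEq S] (e : Fin (m + 1) → S) :
    Finset.univ.image e = insert (e 0) (Finset.univ.image (Fin.tail e)) := by
  ext x
  simp [Fin.exists_fin_succ, Fin.tail, eq_comm]

theorem JoinsUp.join_image_eq_top {e : Fin m → Sym2 (Fin n)} (h : JoinsUp Θ e) :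
    join (Finset.univ.image e) Θ = ⊤ := by
  induction m generalizing Θ with
  | zero => rwa [Finset.univ_eq_empty, Finset.image_empty, join_empty]
  | succ m ih =>
    rw [image_univ_succ, join_insert]
    exact ih h.2

theorem joinsUp_of_join_image_eq_top {e : Fin m → Sym2 (Fin n)}
    (htop : join (Finset.univ.image e) Θ = ⊤) (hΘ : Θ.parts.card = m + 1) : JoinsUp Θ e := by
  induction m generalizing Θ with
  | zero => exact eq_top_of_card_parts_le_one hΘ.le
  | succ m ih =>
    rw [image_univ_succ, join_insert] at htop
    have h0 : ¬ InBlock Θ (e 0) := fun h => by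
      rw [join_singleton_of_inBlock h] at htop
      have hle := card_parts_le_card_parts_join (Finset.univ.image (Fin.tail e)) Θ
      have himage : (Finset.univ.image (Fin.tail e)).card ≤ m :=
        Finset.card_image_le.trans_eq (Finset.card_fin m)
      have htop' := card_parts_top_le_one (α := Fin n)
      rw [htop] at hle
      omega
    have := card_parts_join_singleton h0
    exact ⟨h0, ih htop (by omega)⟩

theorem joinsUp_iff_image_mem_trees (hΘ : Θ.parts.card = m + 1) (e : Fin m → Sym2 (Fin n)) :
    JoinsUp Θ e ↔ Finset.univ.image e ∈ trees Θ := by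
  rw [trees, Finset.mem_filter, Finset.mem_powerset]
  refine ⟨fun h => ⟨fun b hb => ?_, h.join_image_eq_top, ?_⟩,
    fun h => joinsUp_of_join_image_eq_top h.2.1 hΘ⟩
  · obtain ⟨α, -, rfl⟩ := Finset.mem_image.1 hb
    exact Finset.mem_filter.2 ⟨Finset.mem_univ _, fun hd =>
      h.not_inBlock α (inBlock_of_isDiag Θ hd)⟩
  · rw [Finset.card_image_of_injective _ h.injective, hΘ, Finset.card_fin]

end JoinsUp

/-! ### Integration over the simplex -/

section Simplex

open Set

variable {m : ℕ}

theorem measurableSet_simplex (m : ℕ) : MeasurableSet (simplex m) := by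
  have h_inter : simplex m = (⋂ (i : Fin m) (j : Fin m) (_ : i < j), {t | t j < t i}) ∩
      ⋂ α, {t | t α ∈ Ioo (0 : ℝ) 1} := by
    ext t
    simp only [simplex, mem_ofPred_eq, mem_inter_iff, mem_iInter]
    rfl
  rw [h_inter]
  measurability

theorem simplex_subset_Icc (m : ℕ) : simplex m ⊆ Icc 0 1 :=
  fun _ ht => ⟨fun α => (ht.2 α).1.le, fun α => (ht.2 α).2.le⟩

theorem integrableOn_simplex {E : Type*} [NormedAddCommGroup E] {H : (Fin m → ℝ) → E}
    (hH : Continuous H) : IntegrableOn H (simplex m) :=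
  (hH.continuousOn.integrableOn_compact isCompact_Icc).mono_set (simplex_subset_Icc m)

theorem strictAnti_cons_iff {β : Type*} [Preorder β] {b : β} {s : Fin m → β} :
    StrictAnti (Fin.cons b s : Fin (m + 1) → β) ↔ (∀ α, s α < b) ∧ StrictAnti s := by
  refine ⟨fun h => ⟨fun α => by simpa using h (Fin.succ_pos α), fun α β hαβ => by
    simpa using h (Fin.succ_lt_succ_iff.2 hαβ)⟩, fun ⟨hb, hs⟩ => ?_⟩
  simpa [StrictAnti, Fin.forall_fin_succ, hb] using hs

theorem cons_smul_mem_simplex_iff {t : ℝ} {s : Fin m → ℝ} :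
    (Fin.cons t (t • s) : Fin (m + 1) → ℝ) ∈ simplex (m + 1) ↔
      t ∈ Ioo (0 : ℝ) 1 ∧ s ∈ simplex m := by
  have h_mem : (Fin.cons t (t • s) : Fin (m + 1) → ℝ) ∈ simplex (m + 1) ↔
      ((∀ α, t * s α < t) ∧ StrictAnti (t • s)) ∧
        t ∈ Ioo (0 : ℝ) 1 ∧ ∀ α, t * s α ∈ Ioo (0 : ℝ) 1 := by
    simp only [simplex, mem_ofPred_eq, strictAnti_cons_iff, Fin.forall_fin_succ, Fin.cons_zero,
      Fin.cons_succ, Pi.smul_apply, smul_eq_mul]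
  rw [h_mem]
  by_cases ht : t ∈ Ioo (0 : ℝ) 1
  · have h_anti : StrictAnti (t • s) ↔ StrictAnti s := by
      simp only [StrictAnti, Pi.smul_apply, smul_eq_mul, mul_lt_mul_iff_right₀ ht.1]
    have h_lt (α : Fin m) : t * s α < t ↔ s α < 1 := mul_lt_iff_lt_one_right ht.1
    simp only [h_anti, h_lt, ht, true_and, simplex, mem_ofPred_eq, mem_Ioo,
      mul_pos_iff_of_pos_left ht.1]
    exact ⟨fun h => ⟨h.1.2, fun α => ⟨(h.2 α).1, h.1.1 α⟩⟩, fun h => ⟨⟨fun α => (h.2 α).2, h.1⟩,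
      fun α => ⟨(h.2 α).1, ((h_lt α).2 (h.2 α).2).trans ht.2⟩⟩⟩
  · exact iff_of_false (fun h => ht h.2.1) fun h => ht h.1

theorem exists_eq_cons_smul_of_mem_simplex {t : Fin (m + 1) → ℝ} (ht : t ∈ simplex (m + 1)) :
    ∃ r ∈ Ioo (0 : ℝ) 1, ∃ s ∈ simplex m, t = Fin.cons r (r • s) := by
  have h0 : t 0 ≠ 0 := (ht.2 0).1.ne'
  have h_eq : t = Fin.cons (t 0) (t 0 • (t 0)⁻¹ • Fin.tail t) := by
    rw [smul_inv_smul₀ h0, Fin.cons_self_tail]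
  rw [h_eq] at ht
  obtain ⟨hr, hs⟩ := cons_smul_mem_simplex_iff.1 ht
  exact ⟨_, hr, _, hs, h_eq⟩

theorem measurePreserving_cons (m : ℕ) :
    MeasurePreserving fun x : ℝ × (Fin m → ℝ) => (Fin.cons x.1 x.2 : Fin (m + 1) → ℝ) := by
  have h := (volume_preserving_piFinSuccAbove (fun _ : Fin (m + 1) => ℝ) 0).symm
  simp only [MeasurableEquiv.piFinSuccAbove, Fin.insertNthEquiv_zero] at h
  exact h

theorem measurableEmbedding_cons (m : ℕ) :
    MeasurableEmbedding fun x : ℝ × (Fin m → ℝ) => (Fin.cons x.1 x.2 : Fin (m + 1) → ℝ) := by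
  have h := (MeasurableEquiv.piFinSuccAbove (fun _ : Fin (m + 1) => ℝ) 0).symm.measurableEmbedding
  simp only [MeasurableEquiv.piFinSuccAbove, Fin.insertNthEquiv_zero] at h
  exact h

section Integral

variable {E : Type*} [NormedAddCommGroup E] {H : (Fin (m + 1) → ℝ) → E}

theorem integrable_indicator_cons (hH : IntegrableOn H (simplex (m + 1))) :
    Integrable fun x : ℝ × (Fin m → ℝ) => (simplex (m + 1)).indicator H (Fin.cons x.1 x.2) :=
  ((measurePreserving_cons m).integrable_comp_emb (measurableEmbedding_cons m)).2
    ((integrable_indicator_iff (measurableSet_simplex _)).2 hH)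

variable [NormedSpace ℝ E]

theorem integral_indicator_cons (H : (Fin (m + 1) → ℝ) → E) :
    (fun t => ∫ s : Fin m → ℝ, (simplex (m + 1)).indicator H (Fin.cons t s)) =
      (Ioo (0 : ℝ) 1).indicator fun t => t ^ m • ∫ s in simplex m, H (Fin.cons t (t • s)) := by
  ext t
  by_cases ht : t ∈ Ioo (0 : ℝ) 1
  · have h_scale : (fun s : Fin m → ℝ => (simplex (m + 1)).indicator H (Fin.cons t (t • s))) =
        (simplex m).indicator fun s => H (Fin.cons t (t • s)) := by
      classical
      ext s
      exact if_congr (cons_smul_mem_simplex_iff.trans (and_iff_right ht)) rfl rfl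
    have h_integral := Measure.integral_comp_smul_of_nonneg volume
      (fun s : Fin m → ℝ => (simplex (m + 1)).indicator H (Fin.cons t s)) t (hR := ht.1.le)
    rw [h_scale, integral_indicator (measurableSet_simplex m),
      Module.finrank_fintype_fun_eq_card, Fintype.card_fin] at h_integral
    rw [indicator_of_mem ht, h_integral, smul_inv_smul₀ (pow_ne_zero _ ht.1.ne')]
  · have h_notMem (s : Fin m → ℝ) : (Fin.cons t s : Fin (m + 1) → ℝ) ∉ simplex (m + 1) :=
      fun hs => ht (by simpa using hs.2 0)
    simp only [indicator_of_notMem ht, indicator_of_notMem (h_notMem _), integral_zero]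

theorem integrableOn_Ioo_integral_simplex (hH : IntegrableOn H (simplex (m + 1))) :
    IntegrableOn (fun t : ℝ => t ^ m • ∫ s in simplex m, H (Fin.cons t (t • s))) (Ioo 0 1) := by
  rw [← integrable_indicator_iff measurableSet_Ioo, ← integral_indicator_cons]
  exact (integrable_indicator_cons hH).integral_prod_left

theorem integral_simplex_succ (hH : IntegrableOn H (simplex (m + 1))) :
    ∫ t in simplex (m + 1), H t =
      ∫ t in Ioo (0 : ℝ) 1, t ^ m • ∫ s in simplex m, H (Fin.cons t (t • s)) := by
  rw [← integral_indicator (measurableSet_simplex _), ← integral_indicator measurableSet_Ioo,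
    ← integral_indicator_cons, ← (measurePreserving_cons m).integral_comp
      (measurableEmbedding_cons m)]
  exact integral_prod _ (integrable_indicator_cons hH)

end Integral

theorem simplex_zero : simplex 0 = univ :=
  eq_univ_of_forall fun _ => ⟨fun α => α.elim0, fun α => α.elim0⟩

theorem measureReal_simplex (m : ℕ) : volume.real (simplex m) = 1 / (m.factorial : ℝ) := by
  induction m with
  | zero => simp [simplex_zero, Measure.real, volume_pi]
  | succ m ih =>
    have h_succ := integral_simplex_succ (integrableOn_simplex (m := m + 1) (H := fun _ => (1 : ℝ))
      continuous_const)
    simp only [integral_const, measureReal_restrict_apply_univ, smul_eq_mul, mul_one, ih,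
      integral_mul_const] at h_succ
    rw [h_succ, ← integral_Ioc_eq_integral_Ioo, ← intervalIntegral.integral_of_le zero_le_one,
      integral_pow, Nat.factorial_succ]
    push_cast
    simp [div_eq_mul_inv, mul_comm]

theorem volume_simplex (m : ℕ) : volume (simplex m) = ENNReal.ofReal (1 / (m.factorial : ℝ)) := by
  rw [← measureReal_simplex, ofReal_measureReal
    ((measure_mono_top (simplex_subset_Icc m)).mt isCompact_Icc.measure_lt_top.ne)]

end Simplex

/-! ### The tree measures -/

section TreeMeasure

variable {n m : ℕ}

theorem partMatrix_apply (Ψ : SetPart n) (i j : Fin n) [Decidable (SameBlock Ψ i j)] :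
    partMatrix Ψ i j = if SameBlock Ψ i j then 1 else 0 := by
  rw [partMatrix, Matrix.of_apply]
  congr

theorem partMatrix_mem_couplings (Ψ : SetPart n) : partMatrix Ψ ∈ couplings n := by
  classical
  refine ⟨?_, fun i j => ?_, fun i => ?_⟩
  · have h_submatrix : partMatrix Ψ =
        (1 : Matrix (Finset (Fin n)) (Finset (Fin n)) ℝ).submatrix Ψ.part Ψ.part := by
      ext i j
      rw [partMatrix_apply, Matrix.submatrix_apply, Matrix.one_apply]
      simp only [sameBlock_iff_part_eq]
    rw [h_submatrix]
    exact Matrix.PosSemidef.one.submatrix _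
  · rw [partMatrix_apply]
    split_ifs <;> simp
  · rw [partMatrix_apply, if_pos (SameBlock.refl Ψ i)]

theorem convex_couplings (n : ℕ) : Convex ℝ (couplings n) := by
  intro Q hQ Q' hQ' a b ha hb hab
  refine ⟨(hQ.1.smul ha).add (hQ'.1.smul hb), fun i j => ?_, fun i => ?_⟩
  · exact convex_Icc (0 : ℝ) 1 (hQ.2.1 i j) (hQ'.2.1 i j) ha hb hab
  · simp [hQ.2.2 i, hQ'.2.2 i, hab]

theorem isClosed_couplings (n : ℕ) : IsClosed (couplings n) := by
  have h_posSemidef : IsClosed {Q : Matrix (Fin n) (Fin n) ℝ | Q.PosSemidef} := by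
    simp only [Matrix.posSemidef_iff_dotProduct_mulVec, Set.ofPred_and, Set.ofPred_forall]
    refine (isClosed_eq (f := fun Q : Matrix (Fin n) (Fin n) ℝ => Q.conjTranspose)
      (by fun_prop) continuous_id).inter (isClosed_iInter fun x => isClosed_le continuous_const ?_)
    fun_prop
  have h_entries : IsClosed {Q : Matrix (Fin n) (Fin n) ℝ | ∀ i j, Q i j ∈ Set.Icc (0 : ℝ) 1} := by
    simp only [Set.ofPred_forall]
    exact isClosed_iInter fun i => isClosed_iInter fun j => isClosed_Icc.preimage (by fun_prop)
  have h_diag : IsClosed {Q : Matrix (Fin n) (Fin n) ℝ | ∀ i, Q i i = 1} := by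
    simp only [Set.ofPred_forall]
    exact isClosed_iInter fun i => isClosed_eq (by fun_prop) continuous_const
  exact h_posSemidef.inter (h_entries.inter h_diag)

theorem continuous_pathMatrix (Θ : SetPart n) (e : Fin m → Sym2 (Fin n)) :
    Continuous (pathMatrix Θ e) := by
  unfold pathMatrix
  fun_prop

theorem pathMatrix_zero (Θ : SetPart n) (e : Fin 0 → Sym2 (Fin n)) (t : Fin 0 → ℝ) :
    pathMatrix Θ e t = partMatrix Θ := by
  simp [pathMatrix]

theorem pathMatrix_cons (Θ : SetPart n) (e : Fin (m + 1) → Sym2 (Fin n)) (t : ℝ)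
    (s : Fin m → ℝ) :
    pathMatrix Θ e (Fin.cons t (t • s)) =
      (1 - t) • partMatrix Θ + t • pathMatrix (join {e 0} Θ) (Fin.tail e) s := by
  have h_Iic (β : Fin m) : (Finset.Iic β.succ).image e =
      insert (e 0) ((Finset.Iic β).image (Fin.tail e)) := by
    ext x
    simp [Fin.exists_fin_succ, Fin.tail, eq_comm]
  have h_Iio (β : Fin m) : (Finset.Iio β.succ).image e =
      insert (e 0) ((Finset.Iio β).image (Fin.tail e)) := by
    ext x
    simp [Fin.exists_fin_succ, Fin.tail, eq_comm]
  have h_Iic_zero : (Finset.Iic (0 : Fin (m + 1))).image e = {e 0} := by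
    ext x
    simp [eq_comm]
  have h_Iio_zero : (Finset.Iio (0 : Fin (m + 1))).image e = ∅ := by
    ext x
    simp
  rw [pathMatrix, Fin.sum_univ_succ, pathMatrix, h_Iic_zero, h_Iio_zero, join_empty]
  simp only [h_Iic, h_Iio, join_insert, Fin.cons_zero, Fin.cons_succ, Pi.smul_apply, smul_eq_mul,
    mul_smul]
  rw [← Finset.smul_sum, smul_add, smul_sub, sub_smul, one_smul]
  abel

theorem pathMatrix_mem_couplings (Θ : SetPart n) (e : Fin m → Sym2 (Fin n)) {t : Fin m → ℝ}
    (ht : t ∈ simplex m) : pathMatrix Θ e t ∈ couplings n := by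
  induction m generalizing Θ with
  | zero =>
    rw [pathMatrix_zero]
    exact partMatrix_mem_couplings Θ
  | succ m ih =>
    obtain ⟨r, hr, s, hs, rfl⟩ := exists_eq_cons_smul_of_mem_simplex ht
    rw [pathMatrix_cons]
    exact convex_couplings n (partMatrix_mem_couplings Θ) (ih _ _ hs)
      (sub_nonneg.2 hr.2.le) hr.1.le (sub_add_cancel _ _)

theorem card_filter_image_univ_eq {β : Type*} [Fintype β] [DecidableEq β] (Γ : Finset β) :
    (Finset.univ.filter fun e : Fin Γ.card → β => Finset.univ.image e = Γ).card =
      Γ.card.factorial := by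
  have h_equiv : Fintype.card (Fin Γ.card ≃ Γ) = Γ.card.factorial := by
    rw [Fintype.card_equiv Γ.equivFin.symm, Fintype.card_fin]
  rw [← h_equiv, ← Finset.card_univ]
  symm
  refine Finset.card_bij (fun σ _ i => (σ i : β)) (fun σ _ => ?_) (fun σ _ τ _ h => ?_)
    fun e he => ?_
  · refine Finset.mem_filter.2 ⟨Finset.mem_univ _, ?_⟩
    ext x
    simp only [Finset.mem_image, Finset.mem_univ, true_and]
    exact ⟨fun ⟨i, hi⟩ => hi ▸ (σ i).2, fun hx => ⟨σ.symm ⟨x, hx⟩, by simp⟩⟩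
  · ext i
    exact congrFun h i
  · have h_image := (Finset.mem_filter.1 he).2
    have h_mem (i : Fin Γ.card) : e i ∈ Γ :=
      h_image.subset (Finset.mem_image_of_mem e (Finset.mem_univ i))
    have h_surj : Function.Surjective fun i => (⟨e i, h_mem i⟩ : Γ) := by
      rintro ⟨x, hx⟩
      obtain ⟨i, -, hi⟩ := Finset.mem_image.1 (h_image.superset hx)
      exact ⟨i, Subtype.ext hi⟩
    exact ⟨Equiv.ofBijective _ ((Fintype.bijective_iff_surjective_and_card _).2
      ⟨h_surj, by simp⟩), Finset.mem_univ _, rfl⟩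

theorem isProbabilityMeasure_treeMeasure {Θ : SetPart n} {Γ : Finset (Sym2 (Fin n))}
    (hΓ : Γ ∈ trees Θ) : IsProbabilityMeasure (treeMeasure Θ Γ) := by
  have h_card : Θ.parts.card - 1 = Γ.card := by
    have := (Finset.mem_filter.1 hΓ).2.2
    omega
  have h_univ (e : Fin (Θ.parts.card - 1) → Sym2 (Fin n)) :
      (((volume : Measure (Fin (Θ.parts.card - 1) → ℝ)).restrict (simplex _)).map
        (pathMatrix Θ e)) Set.univ = ENNReal.ofReal (1 / (Γ.card.factorial : ℝ)) := by
    rw [Measure.map_apply (continuous_pathMatrix Θ e).measurable MeasurableSet.univ,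
      Set.preimage_univ, Measure.restrict_apply_univ, volume_simplex, h_card]
  constructor
  rw [treeMeasure, Measure.finsetSum_apply, Finset.sum_congr rfl fun e _ => h_univ e,
    Finset.sum_const, h_card, card_filter_image_univ_eq, nsmul_eq_mul, ← ENNReal.ofReal_natCast,
    ← ENNReal.ofReal_mul (by positivity), mul_one_div_cancel (by positivity), ENNReal.ofReal_one]

theorem ae_mem_couplings (Θ : SetPart n) (Γ : Finset (Sym2 (Fin n))) :
    ∀ᵐ Q ∂treeMeasure Θ Γ, Q ∈ couplings n := by
  rw [treeMeasure, ae_finsetSum_measure_iff]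
  intro e _
  rw [ae_map_iff (p := fun Q => Q ∈ couplings n) (continuous_pathMatrix Θ e).measurable.aemeasurable
    (isClosed_couplings n).measurableSet]
  filter_upwards [ae_restrict_mem (measurableSet_simplex _)] with t ht
  exact pathMatrix_mem_couplings Θ e ht

variable {G : Matrix (Fin n) (Fin n) ℝ → ℝ}

theorem integrable_map_pathMatrix (hG : Continuous G) (Θ : SetPart n) (e : Fin m → Sym2 (Fin n)) :
    Integrable G (((volume : Measure (Fin m → ℝ)).restrict (simplex m)).map (pathMatrix Θ e)) :=
  (integrable_map_measure hG.measurable.aestronglyMeasurable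
    (continuous_pathMatrix Θ e).measurable.aemeasurable).2
    (integrableOn_simplex (hG.comp (continuous_pathMatrix Θ e)))

theorem integrable_treeMeasure (hG : Continuous G) (Θ : SetPart n) (Γ : Finset (Sym2 (Fin n))) :
    Integrable G (treeMeasure Θ Γ) :=
  integrable_finsetSum_measure.2 fun e _ => integrable_map_pathMatrix hG Θ e

theorem integral_treeMeasure (hG : Continuous G) (Θ : SetPart n) (Γ : Finset (Sym2 (Fin n))) :
    ∫ Q, G Q ∂treeMeasure Θ Γ = ∑ e ∈ Finset.univ.filter
      (fun e : Fin (Θ.parts.card - 1) → Sym2 (Fin n) => Finset.univ.image e = Γ),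
        ∫ t in simplex _, G (pathMatrix Θ e t) := by
  rw [treeMeasure, integral_finsetSum_measure fun e _ => integrable_map_pathMatrix hG Θ e]
  exact Finset.sum_congr rfl fun e _ => integral_map
    (continuous_pathMatrix Θ e).measurable.aemeasurable hG.measurable.aestronglyMeasurable

end TreeMeasure

/-! ### Surjective colourings -/

section Surjections

open Function Nat Set

variable {S T : Type*}

theorem surjective_cons_iff {k : ℕ} {v : T} {c : Fin k → T} :
    Surjective (Fin.cons v c : Fin (k + 1) → T) ↔ {v}ᶜ ⊆ range c := by
  rw [← range_eq_univ, Fin.range_cons, eq_univ_iff_forall]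
  simp only [mem_insert_iff, or_iff_not_imp_left]
  rfl

theorem ncard_compl_singleton_subset_range [Finite S] [Finite T] (v : T) :
    {c : S → T | {v}ᶜ ⊆ range c}.ncard =
      {c : S → T | Surjective c}.ncard + {c : S → {y // y ≠ v} | Surjective c}.ncard := by
  have h_inj : Injective fun (c : S → {y // y ≠ v}) i => (c i).1 :=
    Subtype.val_injective.comp_left
  have h_union : {c : S → T | {v}ᶜ ⊆ range c} = {c | Surjective c} ∪
      (fun (c : S → {y // y ≠ v}) i => (c i).1) '' {c | Surjective c} := by
    ext c
    simp only [mem_union, mem_ofPred_eq, mem_image]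
    constructor
    · intro hc
      by_cases hv : v ∈ range c
      · exact Or.inl fun y => (eq_or_ne y v).elim (fun h => h ▸ hv) fun h => hc h
      · refine Or.inr ⟨fun i => ⟨c i, fun hi => hv ⟨i, hi⟩⟩, fun ⟨y, hy⟩ => ?_, rfl⟩
        obtain ⟨i, hi⟩ := hc hy
        exact ⟨i, Subtype.ext hi⟩
    · rintro (hc | ⟨d, hd, rfl⟩) y hy
      · exact hc y
      · obtain ⟨i, hi⟩ := hd ⟨y, hy⟩
        exact ⟨i, congrArg Subtype.val hi⟩
  rw [h_union, ncard_union_eq, ncard_image_of_injective _ h_inj]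
  rw [disjoint_left]
  rintro _ hc ⟨d, -, rfl⟩
  obtain ⟨i, hi⟩ := hc v
  exact (d i).2 hi

theorem ncard_surjective_fin_succ [Fintype T] (k : ℕ) :
    {c : Fin (k + 1) → T | Surjective c}.ncard =
      ∑ v, {c : Fin k → T | {v}ᶜ ⊆ range c}.ncard := by
  simp only [← Nat.card_coe_set_eq]
  rw [← Nat.card_sigma]
  refine Nat.card_congr (Equiv.trans ?_
    (Equiv.subtypeProdEquivSigmaSubtype fun v (c : Fin k → T) => {v}ᶜ ⊆ range c))
  exact ((Fin.consEquiv fun _ : Fin (k + 1) => T).subtypeEquiv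
    fun x => (surjective_cons_iff (v := x.1) (c := x.2)).symm).symm

theorem ncard_surjective_fin (k : ℕ) (T : Type*) [Fintype T] :
    {c : Fin k → T | Surjective c}.ncard =
      (Fintype.card T)! * stirlingSecond k (Fintype.card T) := by
  classical
  induction k generalizing T with
  | zero =>
    cases isEmpty_or_nonempty T with
    | inl hT => simp [Surjective]
    | inr hT =>
      obtain ⟨p, hp⟩ := Nat.exists_eq_succ_of_ne_zero (Fintype.card_ne_zero (α := T))
      simp [Surjective, hp]
  | succ k ih =>
    simp only [ncard_surjective_fin_succ, ncard_compl_singleton_subset_range, ih,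
      Fintype.card_subtype_compl, Fintype.card_unique, Finset.sum_const, Finset.card_univ,
      smul_eq_mul]
    rcases Fintype.card T with _ | p
    · simp
    · rw [stirlingSecond_succ_succ, Nat.factorial_succ, Nat.add_sub_cancel]
      ring

theorem ncard_surjective (S T : Type*) [Fintype S] [Fintype T] :
    {c : S → T | Surjective c}.ncard =
      (Fintype.card T)! * stirlingSecond (Fintype.card S) (Fintype.card T) := by
  rw [← ncard_surjective_fin, ← Nat.card_coe_set_eq, ← Nat.card_coe_set_eq]
  refine Nat.card_congr (((Fintype.equivFin S).arrowCongr (Equiv.refl T)).subtypeEquiv fun c => ?_)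
  simp [Equiv.arrowCongr]

theorem coeff_succ_log (p : ℕ) :
    PowerSeries.coeff (p + 1) (PowerSeries.log ℝ) = (-1) ^ p / ((p : ℝ) + 1) := by
  rw [PowerSeries.coeff_log, if_neg (Nat.succ_ne_zero p)]
  simp [pow_succ]

theorem sum_range_coeff_log_mul_stirlingSecond (k M : ℕ) :
    ∑ p ∈ Finset.range (M + 1),
        PowerSeries.coeff p (PowerSeries.log ℝ) * (p ! * stirlingSecond (k + 1) p) =
      stirlingSecond k 0 - (-1) ^ M * (M ! * stirlingSecond k M) := by
  induction M with
  | zero => simp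
  | succ M ih =>
    rw [Finset.sum_range_succ, ih, coeff_succ_log, stirlingSecond_succ_succ, Nat.factorial_succ]
    have : (M : ℝ) + 1 ≠ 0 := by positivity
    push_cast
    field_simp
    ring

/- The squarefree coefficient of `log (exp (t 0 + ⋯ + t k))`, expanded in powers of `exp - 1`. -/
theorem sum_coeff_log_mul_stirlingSecond {k M : ℕ} (hM : k < M) :
    ∑ p ∈ Finset.range (M + 1),
        PowerSeries.coeff p (PowerSeries.log ℝ) * (p ! * stirlingSecond (k + 1) p) =
      if k = 0 then 1 else 0 := by
  rw [sum_range_coeff_log_mul_stirlingSecond, stirlingSecond_eq_zero_of_lt hM]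
  cases k <;> simp

end Surjections

section Colourings

variable {α : Type*} [Fintype α] [DecidableEq α]

/-- The block of a partition containing a given point. -/
def blockOf (Θ : Finpartition (Finset.univ : Finset α)) (i : α) : {A // A ∈ Θ.parts} :=
  ⟨Θ.part i, Θ.part_mem.2 (Finset.mem_univ i)⟩

variable {Θ : Finpartition (Finset.univ : Finset α)}

theorem blockOf_eq_iff {i : α} {A : {A // A ∈ Θ.parts}} : blockOf Θ i = A ↔ i ∈ A.1 := by
  rw [Subtype.ext_iff]
  exact Θ.part_eq_iff_mem A.2

theorem blockOf_eq_blockOf_iff {i j : α} : blockOf Θ i = blockOf Θ j ↔ SameBlock Θ i j := by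
  rw [Subtype.ext_iff, sameBlock_iff_part_eq]
  rfl

theorem blockOf_surjective (Θ : Finpartition (Finset.univ : Finset α)) :
    Function.Surjective (blockOf Θ) := fun A => by
  obtain ⟨i, hi⟩ := Θ.nonempty_of_mem_parts A.2
  exact ⟨i, blockOf_eq_iff.2 hi⟩

theorem le_fiberPartition_iff {β : Type*} {c : α → β} :
    Θ ≤ fiberPartition c ↔ ∃ d, d ∘ blockOf Θ = c := by
  constructor
  · intro hc
    refine ⟨fun A => c (Function.surjInv (blockOf_surjective Θ) A), funext fun i => ?_⟩
    refine sameBlock_fiberPartition.1 (le_iff_sameBlock.1 hc _ _ (blockOf_eq_blockOf_iff.1 ?_))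
    exact Function.surjInv_eq (blockOf_surjective Θ) (blockOf Θ i)
  · rintro ⟨d, rfl⟩
    exact le_iff_sameBlock.2 fun i j hij =>
      sameBlock_fiberPartition.2 (congrArg d (blockOf_eq_blockOf_iff.2 hij))

open scoped Classical in
/-- The surjective colourings that are constant on the blocks of `Θ`. -/
def colourings (Θ : Finpartition (Finset.univ : Finset α)) (p : ℕ) : Finset (α → Fin p) :=
  Finset.univ.filter fun c => Function.Surjective c ∧ Θ ≤ fiberPartition c

theorem mem_colourings {p : ℕ} {c : α → Fin p} :
    c ∈ colourings Θ p ↔ Function.Surjective c ∧ Θ ≤ fiberPartition c := by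
  simp [colourings]

open scoped Classical in
theorem sum_colourings {M : Type*} [AddCommMonoid M]
    (Θ : Finpartition (Finset.univ : Finset α)) (p : ℕ) (φ : (α → Fin p) → M) :
    ∑ c ∈ colourings Θ p, φ c = ∑ d ∈ Finset.univ.filter
      (fun d : {A // A ∈ Θ.parts} → Fin p => Function.Surjective d), φ (d ∘ blockOf Θ) := by
  symm
  refine Finset.sum_bij (fun d _ => d ∘ blockOf Θ) (fun d hd => ?_)
    (fun d _ d' _ h => (blockOf_surjective Θ).injective_comp_right h) (fun c hc => ?_)
    fun _ _ => rfl
  · exact mem_colourings.2 ⟨(Finset.mem_filter.1 hd).2.comp (blockOf_surjective Θ),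
      le_fiberPartition_iff.2 ⟨d, rfl⟩⟩
  · obtain ⟨h_surj, hle⟩ := mem_colourings.1 hc
    obtain ⟨d, rfl⟩ := le_fiberPartition_iff.1 hle
    exact ⟨d, Finset.mem_filter.2 ⟨Finset.mem_univ _, h_surj.of_comp⟩, rfl⟩

theorem card_colourings (Θ : Finpartition (Finset.univ : Finset α)) (p : ℕ) :
    (colourings Θ p).card = p.factorial * Nat.stirlingSecond Θ.parts.card p := by
  classical
  have h_surj := ncard_surjective {A // A ∈ Θ.parts} (Fin p)
  rw [Set.ncard_eq_toFinset_card', Set.toFinset_ofPred, Fintype.card_coe,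
    Fintype.card_fin] at h_surj
  rw [Finset.card_eq_sum_ones, sum_colourings, ← Finset.card_eq_sum_ones, h_surj]

theorem sum_log_card_colourings {m : ℕ} (hΘ : Θ.parts.card = m + 1) :
    ∑ p ∈ Finset.range (Fintype.card α + 1),
        PowerSeries.coeff p (PowerSeries.log ℝ) * (colourings Θ p).card =
      if m = 0 then 1 else 0 := by
  have h_card : m < Fintype.card α := by
    have := Θ.card_parts_le_card
    rw [Finset.card_univ] at this
    omega
  simp only [card_colourings, hΘ, Nat.cast_mul, sum_coeff_log_mul_stirlingSecond h_card]

end Colourings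

section PartitionCumulant

variable {α : Type*} [Fintype α] [DecidableEq α] {Θ : Finpartition (Finset.univ : Finset α)}

/-- The cumulant, over the blocks of `Θ`, of a function `G` of partitions. If `G Ψ` is a product
of moments, one for each block of `Ψ`, then this is the cumulant belonging to these moments: the
colourings `c` enumerate the ordered partitions into `p` nonempty unions of blocks of `Θ`, as in
the expansion of `log (1 + (M - 1))` in powers of `M - 1`. -/
def partitionCumulant (Θ : Finpartition (Finset.univ : Finset α)) :
    (Finpartition (Finset.univ : Finset α) → ℝ) →ₗ[ℝ] ℝ :=
  ∑ p ∈ Finset.range (Fintype.card α + 1), PowerSeries.coeff p (PowerSeries.log ℝ) •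
    ∑ c ∈ colourings Θ p, LinearMap.proj (fiberPartition c)

theorem partitionCumulant_apply (Θ : Finpartition (Finset.univ : Finset α))
    (G : Finpartition (Finset.univ : Finset α) → ℝ) :
    partitionCumulant Θ G = ∑ p ∈ Finset.range (Fintype.card α + 1),
      PowerSeries.coeff p (PowerSeries.log ℝ) * ∑ c ∈ colourings Θ p, G (fiberPartition c) := by
  simp only [partitionCumulant, LinearMap.sum_apply, LinearMap.smul_apply, LinearMap.proj_apply,
    smul_eq_mul]

theorem partitionCumulant_congr {G G' : Finpartition (Finset.univ : Finset α) → ℝ}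
    (h : ∀ Ψ, Θ ≤ Ψ → G Ψ = G' Ψ) : partitionCumulant Θ G = partitionCumulant Θ G' := by
  simp only [partitionCumulant_apply]
  congr! 3 with p _ c hc
  exact h _ (mem_colourings.1 hc).2

theorem partitionCumulant_const {m : ℕ} (hΘ : Θ.parts.card = m + 1) (a : ℝ) :
    partitionCumulant Θ (fun _ => a) = if m = 0 then a else 0 := by
  simp only [partitionCumulant_apply, Finset.sum_const, nsmul_eq_mul, ← mul_assoc,
    ← Finset.sum_mul, sum_log_card_colourings hΘ, ite_mul, one_mul, zero_mul]

theorem integral_partitionCumulant {X : Type*} [MeasurableSpace X] {μ : Measure X}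
    {G : X → Finpartition (Finset.univ : Finset α) → ℝ}
    (hG : ∀ Ψ, Integrable (fun x => G x Ψ) μ) :
    ∫ x, partitionCumulant Θ (G x) ∂μ = partitionCumulant Θ fun Ψ => ∫ x, G x Ψ ∂μ := by
  simp only [partitionCumulant_apply]
  rw [integral_finsetSum _ fun p _ => (integrable_finsetSum _ fun c _ => hG _).const_mul _]
  simp only [integral_const_mul, integral_finsetSum _ fun _ _ => hG _]

open scoped Classical in
theorem partitionCumulant_join {n : ℕ} (Γ : Finset (Sym2 (Fin n))) (Θ : SetPart n)
    (G : SetPart n → ℝ) :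
    partitionCumulant (join Γ Θ) G =
      partitionCumulant Θ fun Ψ => if ∀ b ∈ Γ, InBlock Ψ b then G Ψ else 0 := by
  have h_filter (p : ℕ) : colourings (join Γ Θ) p =
      (colourings Θ p).filter fun c => ∀ b ∈ Γ, InBlock (fiberPartition c) b := by
    ext c
    simp only [Finset.mem_filter, mem_colourings, join_le_iff, and_assoc]
  simp only [partitionCumulant_apply, h_filter, Finset.sum_filter]

end PartitionCumulant

/-! ### Polynomials along a segment -/

section Segment

open AffineMap MvPolynomial

variable {σ : Type*}

section HasDerivAt

variable {𝕜 : Type*} [NontriviallyNormedField 𝕜] [Fintype σ]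

theorem hasDerivAt_eval_comp {u : 𝕜 → σ → 𝕜} {u' : σ → 𝕜} {t : 𝕜} (hu : HasDerivAt u u' t)
    (F : MvPolynomial σ 𝕜) :
    HasDerivAt (fun t => eval (u t) F) (∑ s, u' s * eval (u t) (pderiv s F)) t := by
  classical
  induction F using MvPolynomial.induction_on with
  | C a => simpa using hasDerivAt_const t a
  | add F G hF hG =>
    simp only [map_add, mul_add, Finset.sum_add_distrib]
    exact hF.add hG
  | mul_X F r hF =>
    simp only [map_mul, eval_X]
    refine (hF.mul (hasDerivAt_pi.1 hu r)).congr_deriv ?_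
    simp only [pderiv_mul, pderiv_X, map_add, map_mul, eval_X, mul_add, Finset.sum_add_distrib,
      Finset.sum_mul, mul_assoc]
    simp [Pi.single_apply, apply_ite, mul_comm]

end HasDerivAt

theorem continuous_eval_lineMap (x y : σ → ℝ) (F : MvPolynomial σ ℝ) :
    Continuous fun t : ℝ => eval (lineMap x y t) F :=
  F.continuous_eval.comp lineMap_continuous

theorem integrableOn_Ioo_eval_lineMap (x y : σ → ℝ) (F : MvPolynomial σ ℝ) :
    IntegrableOn (fun t : ℝ => eval (lineMap x y t) F) (Set.Ioo 0 1) :=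
  (continuous_eval_lineMap x y F).integrableOn_Icc.mono_set Set.Ioo_subset_Icc_self

theorem sum_mul_integral_eval_pderiv_lineMap [Fintype σ] (x y : σ → ℝ) (F : MvPolynomial σ ℝ) :
    ∑ s, (y s - x s) * ∫ t in Set.Ioo (0 : ℝ) 1, eval (lineMap x y t) (pderiv s F) =
      eval y F - eval x F := by
  have h_cont : Continuous fun t : ℝ => ∑ s, (y s - x s) * eval (lineMap x y t) (pderiv s F) :=
    continuous_finsetSum _ fun s _ => (continuous_eval_lineMap x y _).const_mul _
  have h_deriv (t : ℝ) : HasDerivAt (fun t => eval (lineMap x y t) F)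
      (∑ s, (y s - x s) * eval (lineMap x y t) (pderiv s F)) t :=
    hasDerivAt_eval_comp hasDerivAt_lineMap F
  have h_ftc := intervalIntegral.integral_eq_sub_of_hasDerivAt
    (fun t _ => h_deriv t)
    (h_cont.intervalIntegrable 0 1)
  rw [lineMap_apply_zero, lineMap_apply_one, intervalIntegral.integral_of_le zero_le_one,
    integral_Ioc_eq_integral_Ioo,
    integral_finsetSum _ fun s _ => (integrableOn_Ioo_eval_lineMap x y _).const_mul _] at h_ftc
  simpa only [integral_const_mul] using h_ftc

variable {R : Type*} [CommRing R]

/-- The polynomial `F` precomposed with the homothety `y ↦ lineMap x y t`. -/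
def compHomothety (x : σ → R) (t : R) : MvPolynomial σ R →ₐ[R] MvPolynomial σ R :=
  aeval fun s => C ((1 - t) * x s) + C t * X s

theorem eval_compHomothety (x y : σ → R) (t : R) (F : MvPolynomial σ R) :
    eval y (compHomothety x t F) = eval (lineMap x y t) F := by
  rw [← aeval_eq_eval, ← aeval_eq_eval, ← AlgHom.comp_apply]
  congr 1
  ext s
  simp [compHomothety, pi_lineMap_apply, lineMap_apply_ring]

theorem pderiv_compHomothety (x : σ → R) (t : R) (s : σ) (F : MvPolynomial σ R) :
    pderiv s (compHomothety x t F) = t • compHomothety x t (pderiv s F) := by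
  classical
  induction F using MvPolynomial.induction_on with
  | C a => simp [compHomothety]
  | add F G hF hG => simp only [map_add, hF, hG, smul_add]
  | mul_X F r hF =>
    have h_X : pderiv s (compHomothety x t (X r)) = t • compHomothety x t (pderiv s (X r)) := by
      rcases eq_or_ne r s with rfl | hrs
      · simp [compHomothety, smul_eq_C_mul]
      · simp [compHomothety, pderiv_X_of_ne hrs]
    rw [map_mul, pderiv_mul, hF, h_X, pderiv_mul, map_add, map_mul, map_mul, smul_add,
      smul_mul_assoc, mul_smul_comm]

/-- The iterated partial derivative along a sequence of variables. -/
def iterPDeriv : {m : ℕ} → (Fin m → σ) → MvPolynomial σ R →ₗ[R] MvPolynomial σ R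
  | 0, _ => LinearMap.id
  | _ + 1, e => iterPDeriv (Fin.tail e) ∘ₗ (pderiv (e 0)).toLinearMap

theorem iterPDeriv_zero (e : Fin 0 → σ) (F : MvPolynomial σ R) : iterPDeriv e F = F := rfl

theorem iterPDeriv_succ {m : ℕ} (e : Fin (m + 1) → σ) (F : MvPolynomial σ R) :
    iterPDeriv e F = iterPDeriv (Fin.tail e) (pderiv (e 0) F) := rfl

theorem iterPDeriv_compHomothety {m : ℕ} (e : Fin m → σ) (x : σ → R) (t : R)
    (F : MvPolynomial σ R) :
    iterPDeriv e (compHomothety x t F) = t ^ m • compHomothety x t (iterPDeriv e F) := by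
  induction m generalizing F with
  | zero => simp only [iterPDeriv_zero, pow_zero, one_smul]
  | succ m ih =>
    rw [iterPDeriv_succ, pderiv_compHomothety, map_smul, ih, smul_smul, ← pow_succ',
      iterPDeriv_succ]

end Segment

/-! ### The interpolation formula -/

section Interpolation

open AffineMap MvPolynomial

variable {n m : ℕ}

/-- The entries of a matrix as a function on unordered pairs. Symmetrizing makes this a continuous
function of arbitrary matrices. -/
def entries (Q : Matrix (Fin n) (Fin n) ℝ) : Sym2 (Fin n) → ℝ :=
  Sym2.lift ⟨fun i j => (Q i j + Q j i) / 2, fun i j => by simp only [add_comm]⟩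

theorem entries_mk (Q : Matrix (Fin n) (Fin n) ℝ) (i j : Fin n) :
    entries Q s(i, j) = (Q i j + Q j i) / 2 := rfl

theorem continuous_entries : Continuous (entries (n := n)) := by
  refine continuous_pi fun b => ?_
  induction b using Sym2.ind with
  | _ i j =>
    simp only [entries_mk]
    fun_prop

theorem entries_of_mem_couplings {Q : Matrix (Fin n) (Fin n) ℝ} (hQ : Q ∈ couplings n)
    (i j : Fin n) : entries Q s(i, j) = Q i j := by
  have h_symm : Q j i = Q i j := by simpa using hQ.1.isHermitian.apply i j
  rw [entries_mk, h_symm, add_self_div_two]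

open scoped Classical in
theorem entries_partMatrix (Ψ : SetPart n) (b : Sym2 (Fin n)) :
    entries (partMatrix Ψ) b = if InBlock Ψ b then 1 else 0 := by
  induction b using Sym2.ind with
  | _ i j => simp only [entries_of_mem_couplings (partMatrix_mem_couplings Ψ), partMatrix_apply,
      inBlock_mk]

theorem entries_pathMatrix_cons (Θ : SetPart n) (e : Fin (m + 1) → Sym2 (Fin n)) (t : ℝ)
    (s : Fin m → ℝ) :
    entries (pathMatrix Θ e (Fin.cons t (t • s))) = lineMap (entries (partMatrix Θ))
      (entries (pathMatrix (join {e 0} Θ) (Fin.tail e) s)) t := by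
  ext b
  rw [pathMatrix_cons, pi_lineMap_apply, lineMap_apply_ring]
  induction b using Sym2.ind with
  | _ i j =>
    simp only [entries_mk, Matrix.add_apply, Matrix.smul_apply, smul_eq_mul]
    ring

theorem continuous_eval_entries (F : MvPolynomial (Sym2 (Fin n)) ℝ) :
    Continuous fun Q : Matrix (Fin n) (Fin n) ℝ => eval (entries Q) F :=
  F.continuous_eval.comp continuous_entries

open scoped Classical in
/-- The sum over the ordered trees `e` of the derivatives of `F` along `e`, integrated over the
paths from `[Θ]` to the all-ones matrix that join the blocks of `Θ` in the order `e`. -/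
def treeSum (m : ℕ) (Θ : SetPart n) (F : MvPolynomial (Sym2 (Fin n)) ℝ) : ℝ :=
  ∑ e ∈ Finset.univ.filter (JoinsUp (m := m) Θ),
    ∫ t in simplex m, eval (entries (pathMatrix Θ e t)) (iterPDeriv e F)

open scoped Classical in
theorem treeSum_zero {Θ : SetPart n} (hΘ : Θ.parts.card = 1)
    (F : MvPolynomial (Sym2 (Fin n)) ℝ) : treeSum 0 Θ F = eval (entries (partMatrix Θ)) F := by
  have h_filter : Finset.univ.filter (JoinsUp (m := 0) Θ) = Finset.univ :=
    Finset.filter_true_of_mem fun _ _ => eq_top_of_card_parts_le_one hΘ.le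
  rw [treeSum, h_filter]
  simp [pathMatrix_zero, iterPDeriv_zero, measureReal_simplex]

theorem pow_smul_integral_simplex_pathMatrix (Θ : SetPart n) (e : Fin (m + 1) → Sym2 (Fin n))
    (F : MvPolynomial (Sym2 (Fin n)) ℝ) (t : ℝ) :
    t ^ m • ∫ s in simplex m,
        eval (entries (pathMatrix Θ e (Fin.cons t (t • s)))) (iterPDeriv e F) =
      ∫ s in simplex m, eval (entries (pathMatrix (join {e 0} Θ) (Fin.tail e) s))
        (iterPDeriv (Fin.tail e) (compHomothety (entries (partMatrix Θ)) t (pderiv (e 0) F))) := by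
  rw [← integral_smul]
  simp only [entries_pathMatrix_cons, iterPDeriv_compHomothety, iterPDeriv_succ, smul_eval,
    eval_compHomothety, smul_eq_mul]

open scoped Classical in
theorem sum_joinsUp_succ {M : Type*} [AddCommMonoid M] (Θ : SetPart n)
    (φ : (Fin (m + 1) → Sym2 (Fin n)) → M) :
    ∑ e ∈ Finset.univ.filter (JoinsUp Θ), φ e =
      ∑ b ∈ Finset.univ.filter (fun b => ¬ InBlock Θ b),
        ∑ e ∈ Finset.univ.filter (JoinsUp (m := m) (join {b} Θ)), φ (Fin.cons b e) := by
  simp only [Finset.sum_filter]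
  rw [← (Fin.consEquiv fun _ : Fin (m + 1) => Sym2 (Fin n)).sum_comp, Fintype.sum_prod_type]
  refine Finset.sum_congr rfl fun b _ => ?_
  by_cases hb : InBlock Θ b <;> simp [Fin.consEquiv, JoinsUp, hb]

open scoped Classical in
theorem treeSum_succ (Θ : SetPart n) (F : MvPolynomial (Sym2 (Fin n)) ℝ) :
    treeSum (m + 1) Θ F = ∑ b ∈ Finset.univ.filter (fun b => ¬ InBlock Θ b),
      ∫ t in Set.Ioo (0 : ℝ) 1,
        treeSum m (join {b} Θ) (compHomothety (entries (partMatrix Θ)) t (pderiv b F)) := by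
  have h_int (e : Fin (m + 1) → Sym2 (Fin n)) : IntegrableOn
      (fun t => eval (entries (pathMatrix Θ e t)) (iterPDeriv e F)) (simplex (m + 1)) :=
    integrableOn_simplex ((continuous_eval_entries _).comp (continuous_pathMatrix Θ e))
  rw [treeSum, sum_joinsUp_succ]
  refine Finset.sum_congr rfl fun b _ => ?_
  have h_term (e : Fin m → Sym2 (Fin n)) := integrableOn_Ioo_integral_simplex (h_int (Fin.cons b e))
  simp only [pow_smul_integral_simplex_pathMatrix, Fin.cons_zero, Fin.tail_cons] at h_term
  simp only [treeSum, integral_finsetSum _ fun e _ => h_term e, integral_simplex_succ (h_int _),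
    pow_smul_integral_simplex_pathMatrix, Fin.cons_zero, Fin.tail_cons]

open scoped Classical in
theorem sum_integral_pderiv_lineMap_partMatrix {Θ Ψ : SetPart n} (h : Θ ≤ Ψ)
    (F : MvPolynomial (Sym2 (Fin n)) ℝ) :
    ∑ b ∈ Finset.univ.filter (fun b => ¬ InBlock Θ b),
        (if InBlock Ψ b then ∫ t in Set.Ioo (0 : ℝ) 1,
          eval (lineMap (entries (partMatrix Θ)) (entries (partMatrix Ψ)) t) (pderiv b F) else 0) =
      eval (entries (partMatrix Ψ)) F - eval (entries (partMatrix Θ)) F := by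
  rw [← sum_mul_integral_eval_pderiv_lineMap, Finset.sum_filter]
  refine Finset.sum_congr rfl fun b _ => ?_
  have h_mono : InBlock Θ b → InBlock Ψ b := fun hb => hb.mono h
  rw [entries_partMatrix Θ, entries_partMatrix Ψ]
  split_ifs <;> simp_all

theorem treeSum_eq_partitionCumulant {Θ : SetPart n} (hΘ : Θ.parts.card = m + 1)
    (F : MvPolynomial (Sym2 (Fin n)) ℝ) :
    treeSum m Θ F = partitionCumulant Θ fun Ψ => eval (entries (partMatrix Ψ)) F := by
  classical
  induction m generalizing Θ F with
  | zero =>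
    have h_eq (Ψ : SetPart n) (h : Θ ≤ Ψ) : Ψ = Θ :=
      le_antisymm (eq_top_of_card_parts_le_one hΘ.le ▸ le_top) h
    rw [treeSum_zero hΘ, partitionCumulant_congr (G' := fun _ => eval (entries (partMatrix Θ)) F)
      fun Ψ h => by rw [h_eq Ψ h], partitionCumulant_const hΘ, if_pos rfl]
  | succ m ih =>
    let x := entries (partMatrix Θ)
    let J (b : Sym2 (Fin n)) (Ψ : SetPart n) : ℝ :=
      ∫ t in Set.Ioo (0 : ℝ) 1, eval (lineMap x (entries (partMatrix Ψ)) t) (pderiv b F)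
    have h_bond (b : Sym2 (Fin n)) (hb : ¬ InBlock Θ b) :
        ∫ t in Set.Ioo (0 : ℝ) 1, treeSum m (join {b} Θ) (compHomothety x t (pderiv b F)) =
          partitionCumulant Θ fun Ψ => if InBlock Ψ b then J b Ψ else 0 := by
      have h_card : (join {b} Θ).parts.card = m + 1 := by
        have := card_parts_join_singleton hb
        omega
      simp only [ih h_card, eval_compHomothety]
      rw [integral_partitionCumulant fun Ψ => integrableOn_Ioo_eval_lineMap _ _ _,
        partitionCumulant_join]
      simp only [Finset.mem_singleton, forall_eq, J]
    calc treeSum (m + 1) Θ F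
        = ∑ b ∈ Finset.univ.filter (fun b => ¬ InBlock Θ b),
            partitionCumulant Θ fun Ψ => if InBlock Ψ b then J b Ψ else 0 := by
          rw [treeSum_succ]
          exact Finset.sum_congr rfl fun b hb => h_bond b (Finset.mem_filter.1 hb).2
      _ = partitionCumulant Θ fun Ψ => eval (entries (partMatrix Ψ)) F - eval x F := by
          rw [← map_sum]
          refine partitionCumulant_congr fun Ψ h => ?_
          rw [Finset.sum_apply, sum_integral_pderiv_lineMap_partMatrix h]
      _ = partitionCumulant Θ fun Ψ => eval (entries (partMatrix Ψ)) F := by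
          have h_const := partitionCumulant_const hΘ (eval x F)
          rw [if_neg m.succ_ne_zero] at h_const
          exact (map_sub (partitionCumulant Θ) _ _).trans (by rw [h_const, sub_zero])

end Interpolation

/-! ### Joint cumulants as sums over colourings -/

section SquarefreeCoefficient

variable {S β : Type*} [Fintype S] [DecidableEq β]

/-- The exponent vector of the product of the variables in the colour class `c ⁻¹' {j}`. -/
def classExponent (c : S → β) (j : β) : S →₀ ℕ :=
  Finsupp.equivFunOnFinite.symm fun s => if c s = j then 1 else 0

theorem classExponent_apply (c : S → β) (j : β) (s : S) :
    classExponent c j s = if c s = j then 1 else 0 := rfl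

theorem classExponent_injective : Function.Injective (classExponent (S := S) (β := β)) :=
  fun c d h => funext fun s => by
    have h_apply := DFunLike.congr_fun (congrFun h (c s)) s
    by_contra! hne
    simp [classExponent_apply, hne.symm] at h_apply

theorem classExponent_eq_zero_iff {c : S → β} {j : β} :
    classExponent c j = 0 ↔ j ∉ Set.range c := by
  simp [Finsupp.ext_iff, classExponent_apply]

variable [Fintype β]

theorem sum_classExponent (c : S → β) :
    ∑ j, classExponent c j = Finsupp.equivFunOnFinite.symm fun _ => 1 := by
  ext s
  simp [Finsupp.finsetSum_apply, classExponent_apply]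

theorem exists_classExponent_eq {l : β → S →₀ ℕ}
    (hl : ∑ j, l j = Finsupp.equivFunOnFinite.symm fun _ => 1) : ∃ c, classExponent c = l := by
  have h_single (s : S) : ∃ j, Finsupp.equivFunOnFinite.symm (fun k => l k s) =
      Finsupp.single j 1 := by
    rw [← Finsupp.sum_eq_one_iff, Finsupp.sum_fintype _ _ fun _ => rfl]
    simpa [Finsupp.finsetSum_apply] using DFunLike.congr_fun hl s
  choose c hc using h_single
  refine ⟨c, ?_⟩
  ext j s
  rw [classExponent_apply, ← Finsupp.single_apply, ← hc]
  rfl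

open scoped Classical in
theorem coeff_squarefree_prod {R : Type*} [CommSemiring R] (U : β → MvPowerSeries S R) :
    MvPowerSeries.coeff (Finsupp.equivFunOnFinite.symm fun _ => 1) (∏ j, U j) =
      ∑ c : S → β, ∏ j, MvPowerSeries.coeff (classExponent c j) (U j) := by
  rw [MvPowerSeries.coeff_prod]
  symm
  refine Finset.sum_bij (fun c _ => Finsupp.equivFunOnFinite.symm (classExponent c))
    (fun c _ => ?_) (fun c _ d _ h => ?_) (fun l hl => ?_) fun _ _ => rfl
  · exact Finset.mem_finsuppAntidiag.2 ⟨sum_classExponent c, Finset.subset_univ _⟩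
  · exact classExponent_injective (Finsupp.equivFunOnFinite.symm.injective h)
  · obtain ⟨c, hc⟩ := exists_classExponent_eq (Finset.mem_finsuppAntidiag.1 hl).1
    exact ⟨c, Finset.mem_univ c, by rw [hc, Equiv.symm_apply_eq]; rfl⟩

end SquarefreeCoefficient

section JointCumulant

variable {S Ω : Type*} [Fintype S] [MeasurableSpace Ω]

theorem coeff_formalMGF (P : Measure Ω) (X : S → Ω → ℝ) (ν : S →₀ ℕ) :
    MvPowerSeries.coeff ν (formalMGF P X) =
      (∫ ω, ∏ s, X s ω ^ ν s ∂P) / ∏ s, ((ν s).factorial : ℝ) := rfl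

theorem coeff_classExponent_formalMGF {β : Type*} [DecidableEq β] (P : Measure Ω) (X : S → Ω → ℝ)
    (c : S → β) (j : β) : MvPowerSeries.coeff (classExponent c j) (formalMGF P X) =
      ∫ ω, ∏ s ∈ Finset.univ.filter (fun s => c s = j), X s ω ∂P := by
  have h_factorial (s : S) : (classExponent c j s).factorial = 1 := by
    rw [classExponent_apply]
    split_ifs <;> rfl
  simp only [coeff_formalMGF, h_factorial, Nat.cast_one, Finset.prod_const_one, div_one]
  simp only [classExponent_apply, pow_ite, pow_one, pow_zero, Finset.prod_filter]

variable (P : Measure Ω) [IsProbabilityMeasure P] (X : S → Ω → ℝ)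

theorem coeff_zero_formalMGF_sub_one : MvPowerSeries.coeff 0 (formalMGF P X - 1) = 0 := by
  rw [map_sub, coeff_formalMGF, MvPowerSeries.coeff_zero_one]
  simp

open scoped Classical in
theorem coeff_squarefree_formalMGF_sub_one_pow (p : ℕ) :
    MvPowerSeries.coeff (Finsupp.equivFunOnFinite.symm fun _ => 1) ((formalMGF P X - 1) ^ p) =
      ∑ c ∈ Finset.univ.filter (fun c : S → Fin p => Function.Surjective c),
        ∏ j, ∫ ω, ∏ s ∈ Finset.univ.filter (fun s => c s = j), X s ω ∂P := by
  have h_prod := coeff_squarefree_prod fun _ : Fin p => formalMGF P X - 1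
  rw [Finset.prod_const, Finset.card_univ, Fintype.card_fin] at h_prod
  rw [h_prod, Finset.sum_filter]
  refine Finset.sum_congr rfl fun c _ => ?_
  split_ifs with hc
  · refine Finset.prod_congr rfl fun j _ => ?_
    have h_ne : classExponent c j ≠ 0 := fun h => classExponent_eq_zero_iff.1 h (hc j)
    rw [map_sub, coeff_classExponent_formalMGF, MvPowerSeries.coeff_one, if_neg h_ne, sub_zero]
  · obtain ⟨j, hj⟩ := not_forall.1 hc
    refine Finset.prod_eq_zero (Finset.mem_univ j) ?_
    rw [classExponent_eq_zero_iff.2 hj, coeff_zero_formalMGF_sub_one]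

open scoped Classical in
theorem jointCumulant_eq_sum {K : ℕ} (hK : Fintype.card S ≤ K) :
    jointCumulant P X = ∑ p ∈ Finset.range (K + 1), PowerSeries.coeff p (PowerSeries.log ℝ) *
      ∑ c ∈ Finset.univ.filter (fun c : S → Fin p => Function.Surjective c),
        ∏ j, ∫ ω, ∏ s ∈ Finset.univ.filter (fun s => c s = j), X s ω ∂P := by
  have h_subst : PowerSeries.HasSubst (formalMGF P X - 1) :=
    PowerSeries.HasSubst.of_constantCoeff_zero (coeff_zero_formalMGF_sub_one P X)
  rw [jointCumulant, PowerSeries.coeff_subst h_subst]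
  simp only [coeff_squarefree_formalMGF_sub_one_pow, smul_eq_mul]
  refine finsum_eq_sum_of_support_subset _ fun p hp => ?_
  rw [Finset.coe_range, Set.mem_Iio]
  by_contra! hlt
  refine hp ?_
  have h_empty : Finset.univ.filter (fun c : S → Fin p => Function.Surjective c) = ∅ := by
    refine Finset.filter_eq_empty_iff.2 fun c _ hc => ?_
    have := Fintype.card_le_of_surjective c hc
    rw [Fintype.card_fin] at this
    omega
  simp only [h_empty, Finset.sum_empty, mul_zero]

end JointCumulant

/-! ### Expectations of polynomials in recoupled families -/

section BondOperators

open MvPolynomial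

variable {n N : ℕ}

theorem bondOp_mk (i i' : Fin n) (g : MvPolynomial (Var n N) ℝ) :
    bondOp N s(i, i') g = ∑ j, pderiv (i, j) (pderiv (i', j) g) := by
  simp only [bondOp, Sym2.lift_mk, LinearMap.sum_apply]
  rfl

theorem bondOp_one (b : Sym2 (Fin n)) : bondOp N b 1 = 0 := by
  induction b with | _ i i'
  simp [bondOp_mk]

theorem bondOp_pderiv (b : Sym2 (Fin n)) (q : Var n N) (g : MvPolynomial (Var n N) ℝ) :
    bondOp N b (pderiv q g) = pderiv q (bondOp N b g) := by
  induction b with | _ i i'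
  simp only [bondOp_mk, map_sum, pderiv_pderiv_comm q]

theorem pderiv_X_mul (r p : Var n N) (g : MvPolynomial (Var n N) ℝ) :
    pderiv r (X p * g) = X p * pderiv r g + if r = p then g else 0 := by
  rw [pderiv_mul, pderiv_X, Pi.single_apply, ite_mul, one_mul, zero_mul, add_comm]
  simp only [eq_comm]

theorem bondOp_X_mul (i i' : Fin n) (p : Var n N) (g : MvPolynomial (Var n N) ℝ) :
    bondOp N s(i, i') (X p * g) = X p * bondOp N s(i, i') g +
      ((if p.1 = i' then pderiv (i, p.2) g else 0) +
        if p.1 = i then pderiv (i', p.2) g else 0) := by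
  obtain ⟨k, l⟩ := p
  have h_sum (a a' : Fin n) : (∑ j, if (a, j) = (k, l) then pderiv (a', j) g else 0) =
      if k = a then pderiv (a', l) g else 0 := by
    simp only [Prod.mk.injEq, eq_comm (a := k), ite_and]
    split_ifs <;> simp
  simp only [bondOp_mk, pderiv_X_mul, map_add, apply_ite (pderiv _), map_zero,
    Finset.sum_add_distrib, ← Finset.mul_sum, h_sum]
  abel

theorem treeOp_empty : treeOp N (∅ : Finset (Sym2 (Fin n))) = 1 :=
  Finset.noncommProd_empty _ _

theorem treeOp_insert {b : Sym2 (Fin n)} {Γ : Finset (Sym2 (Fin n))} (hb : b ∉ Γ) :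
    treeOp N (insert b Γ) = treeOp N Γ * bondOp N b :=
  Finset.noncommProd_insert_of_notMem' Γ b (bondOp N) (fun e _ e' _ _ => bondOp_commute e e') hb

end BondOperators

section RecoupledMean

open MvPolynomial

variable {n N : ℕ} {Ω : Type*} [MeasurableSpace Ω]

/-- The covariances of the recoupled family `ζ ⋆ Q`, as polynomials in the entries of `Q`. The
variable attached to the bond or loop `s(i, i')` stands for `Q i i'`. -/
def recoupledCov (P : Measure Ω) (ζ : Var n N → Ω → ℝ) (p q : Var n N) :
    MvPolynomial (Sym2 (Fin n)) ℝ :=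
  C (secondMoment P ζ p q) * X s(p.1, q.1)

/-- The expectation `E[g(ζ ⋆ Q)]`, as a polynomial in the entries of `Q`. -/
def recoupledMean (P : Measure Ω) (ζ : Var n N → Ω → ℝ) :
    MvPolynomial (Var n N) ℝ →ₗ[ℝ] MvPolynomial (Sym2 (Fin n)) ℝ :=
  wick (recoupledCov P ζ)

variable (P : Measure Ω) (ζ : Var n N → Ω → ℝ)

theorem recoupledCov_comm (p q : Var n N) : recoupledCov P ζ p q = recoupledCov P ζ q p := by
  rw [recoupledCov, recoupledCov, secondMoment_comm, Sym2.eq_swap]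

theorem recoupledMean_one : recoupledMean P ζ 1 = 1 := wick_one _

theorem recoupledMean_X_mul (p : Var n N) (g : MvPolynomial (Var n N) ℝ) :
    recoupledMean P ζ (X p * g) =
      ∑ q, recoupledCov P ζ p q * recoupledMean P ζ (pderiv q g) :=
  wick_X_mul (recoupledCov_comm P ζ) p g

theorem eval_recoupledMean (x : Sym2 (Fin n) → ℝ) (g : MvPolynomial (Var n N) ℝ) :
    eval x (recoupledMean P ζ g) =
      wick (fun p q => x s(p.1, q.1) * secondMoment P ζ p q) g := by
  rw [← coe_aeval_eq_eval]
  refine (algHom_wick (aeval x) (recoupledCov_comm P ζ) g).trans ?_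
  simp [recoupledCov, mul_comm]

variable {P ζ}

theorem integral_recoupling {Ω' : Type*} [MeasurableSpace Ω'] {P' : Measure Ω'}
    {ζ' : Var n N → Ω' → ℝ} {Q : Matrix (Fin n) (Fin n) ℝ} (hQ : Q ∈ couplings n)
    (h : IsRecoupling P ζ Q P' ζ') (g : MvPolynomial (Var n N) ℝ) :
    ∫ ω, polyVar g ζ' ω ∂P' = eval (entries Q) (recoupledMean P ζ g) := by
  have h_cov : secondMoment P' ζ' = fun p q => entries Q s(p.1, q.1) * secondMoment P ζ p q := by
    ext p q
    rw [entries_of_mem_couplings hQ]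
    exact h.covariance p q
  rw [eval_recoupledMean, ← h_cov]
  exact h.centred.integral_eval g

theorem sum_pderiv_recoupledCov_mul
    (hcov : ∀ p q, secondMoment P ζ p q = if p.2 = q.2 then bondCov P ζ s(p.1, q.1) else 0)
    {i i' : Fin n} (hne : i ≠ i') (p : Var n N) (φ : Var n N → MvPolynomial (Sym2 (Fin n)) ℝ) :
    ∑ q, pderiv s(i, i') (recoupledCov P ζ p q) * φ q = bondCov P ζ s(i, i') •
      ((if p.1 = i' then φ (i, p.2) else 0) + if p.1 = i then φ (i', p.2) else 0) := by
  have h_term (k : Fin n) (l : Fin (2 * N + 1)) :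
      pderiv s(i, i') (recoupledCov P ζ p (k, l)) * φ (k, l) =
        if p.2 = l then if s(p.1, k) = s(i, i') then bondCov P ζ s(i, i') • φ (k, l) else 0
          else 0 := by
    rw [recoupledCov, hcov, pderiv_C_mul, pderiv_X, Pi.single_apply]
    split_ifs with h_bond h_index <;> simp [*, smul_eq_C_mul]
  have h_bond (k : Fin n) (r : MvPolynomial (Sym2 (Fin n)) ℝ) :
      (if s(p.1, k) = s(i, i') then r else 0) =
        (if k = i then if p.1 = i' then r else 0 else 0) +
          if k = i' then if p.1 = i then r else 0 else 0 := by
    simp only [Sym2.eq_iff]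
    grind
  simp only [Fintype.sum_prod_type, h_term, Finset.sum_ite_eq, Finset.mem_univ, if_true, h_bond,
    Finset.sum_add_distrib, Finset.sum_ite_eq', smul_add, smul_ite, smul_zero]

theorem pderiv_recoupledMean
    (hcov : ∀ p q, secondMoment P ζ p q = if p.2 = q.2 then bondCov P ζ s(p.1, q.1) else 0)
    {b : Sym2 (Fin n)} (hb : ¬ b.IsDiag) (g : MvPolynomial (Var n N) ℝ) :
    pderiv b (recoupledMean P ζ g) = bondCov P ζ b • recoupledMean P ζ (bondOp N b g) := by
  let T : MvPolynomial (Var n N) ℝ →ₗ[ℝ] MvPolynomial (Sym2 (Fin n)) ℝ :=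
    (pderiv b).toLinearMap ∘ₗ recoupledMean P ζ -
      bondCov P ζ b • (recoupledMean P ζ ∘ₗ bondOp N b)
  have hT (g : MvPolynomial (Var n N) ℝ) : T g = pderiv b (recoupledMean P ζ g) -
      bondCov P ζ b • recoupledMean P ζ (bondOp N b g) := rfl
  refine sub_eq_zero.1 (eq_zero_of_wick_recursion (A := Set.univ) (recoupledCov P ζ) T ?_
    (fun p _ g _ => ?_) (g := g) (by simp))
  · rw [hT, recoupledMean_one, pderiv_one, bondOp_one, map_zero, smul_zero, sub_zero]
  · induction b with | _ i i'
    have h_pderiv : pderiv s(i, i') (recoupledMean P ζ (X p * g)) =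
        ∑ q, pderiv s(i, i') (recoupledCov P ζ p q) * recoupledMean P ζ (pderiv q g) +
        ∑ q, recoupledCov P ζ p q * pderiv s(i, i') (recoupledMean P ζ (pderiv q g)) := by
      rw [recoupledMean_X_mul, map_sum, ← Finset.sum_add_distrib]
      exact Finset.sum_congr rfl fun q _ => pderiv_mul
    have h_bondOp : recoupledMean P ζ (bondOp N s(i, i') (X p * g)) =
        ∑ q, recoupledCov P ζ p q * recoupledMean P ζ (bondOp N s(i, i') (pderiv q g)) +
        ((if p.1 = i' then recoupledMean P ζ (pderiv (i, p.2) g) else 0) +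
          if p.1 = i then recoupledMean P ζ (pderiv (i', p.2) g) else 0) := by
      simp only [bondOp_X_mul, map_add, recoupledMean_X_mul, bondOp_pderiv,
        apply_ite (recoupledMean P ζ), map_zero]
    rw [hT, h_pderiv, h_bondOp, sum_pderiv_recoupledCov_mul hcov hb p]
    simp only [hT, mul_sub, Finset.sum_sub_distrib, mul_smul_comm, ← Finset.smul_sum]
    module

theorem iterPDeriv_recoupledMean
    (hcov : ∀ p q, secondMoment P ζ p q = if p.2 = q.2 then bondCov P ζ s(p.1, q.1) else 0)
    {m : ℕ} {e : Fin m → Sym2 (Fin n)} (he : Function.Injective e) (hd : ∀ α, ¬ (e α).IsDiag)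
    (g : MvPolynomial (Var n N) ℝ) :
    iterPDeriv e (recoupledMean P ζ g) = (∏ b ∈ Finset.univ.image e, bondCov P ζ b) •
      recoupledMean P ζ (treeOp N (Finset.univ.image e) g) := by
  induction m generalizing g with
  | zero =>
    rw [iterPDeriv_zero, Finset.univ_eq_empty, Finset.image_empty, Finset.prod_empty, one_smul,
      treeOp_empty, Module.End.one_apply]
  | succ m ih =>
    have h_notMem : e 0 ∉ Finset.univ.image (Fin.tail e) := by
      intro h
      obtain ⟨α, -, hα⟩ := Finset.mem_image.1 h
      exact Fin.succ_ne_zero α (he hα)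
    have h_tail : Function.Injective (Fin.tail e) := he.comp (Fin.succ_injective m)
    rw [iterPDeriv_succ, pderiv_recoupledMean hcov (hd 0), map_smul,
      ih h_tail fun α => hd α.succ, image_univ_succ, treeOp_insert h_notMem,
      Finset.prod_insert h_notMem, smul_smul, Module.End.mul_apply]

section Factorization

variable {Θ : SetPart n} {f : {A // A ∈ Θ.parts} → MvPolynomial (Var n N) ℝ}

open scoped Classical in
theorem prod_filter_mem_supported
    (hf : ∀ A, f A ∈ supported ℝ {p : Var n N | p.1 ∈ A.1}) {k : ℕ}
    (d : {A // A ∈ Θ.parts} → Fin k) (j : Fin k) :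
    ∏ A ∈ Finset.univ.filter (fun A => d A = j), f A ∈
      supported ℝ {p : Var n N | d (blockOf Θ p.1) = j} := by
  refine prod_mem fun A hA => supported_mono (fun p hp => ?_) (hf A)
  have h_block : blockOf Θ p.1 = A := blockOf_eq_iff.2 hp
  rw [Set.mem_ofPred_eq, h_block]
  exact (Finset.mem_filter.1 hA).2

-- Colour classes are uncorrelated under the coupling by the partition into colour classes, while
-- inside a class the coupled covariances are those of `ζ`.
open scoped Classical in
theorem eval_partMatrix_recoupledMean_prod (hζ : IsCentredGaussian P ζ)
    (hf : ∀ A, f A ∈ supported ℝ {p : Var n N | p.1 ∈ A.1}) {k : ℕ}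
    (d : {A // A ∈ Θ.parts} → Fin k) :
    eval (entries (partMatrix (fiberPartition (d ∘ blockOf Θ)))) (recoupledMean P ζ (∏ A, f A)) =
      ∏ j, ∫ ω, ∏ A ∈ Finset.univ.filter (fun A => d A = j), polyVar (f A) ζ ω ∂P := by
  let c : Var n N → Var n N → ℝ := fun p q =>
    entries (partMatrix (fiberPartition (d ∘ blockOf Θ))) s(p.1, q.1) * secondMoment P ζ p q
  have h_comm (p q : Var n N) : c p q = c q p := by
    simp only [c, secondMoment_comm P ζ p, Sym2.eq_swap (a := p.1)]
  have hc (p q : Var n N) : c p q =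
      if d (blockOf Θ p.1) = d (blockOf Θ q.1) then secondMoment P ζ p q else 0 := by
    simp only [c, entries_partMatrix, inBlock_mk, sameBlock_fiberPartition, Function.comp_apply,
      ite_mul, one_mul, zero_mul]
  rw [eval_recoupledMean, ← Finset.prod_fiberwise_of_maps_to (fun A _ => Finset.mem_univ (d A)) f,
    wick_prod_of_uncorrelated h_comm (A := fun j => {p | d (blockOf Θ p.1) = j})
      (fun i j hij p hp q hq => ?_) (prod_filter_mem_supported hf d)]
  · refine Finset.prod_congr rfl fun j _ => ?_
    rw [wick_congr_of_mem_supported h_comm (secondMoment_comm P ζ) (fun p hp q hq => ?_)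
      (prod_filter_mem_supported hf d j), ← hζ.integral_eval]
    · simp only [map_prod, polyVar]
    · rw [hc, if_pos (Eq.trans hp (Eq.symm hq))]
  · rw [hc, if_neg fun h => hij (Eq.trans (Eq.symm hp) (h.trans hq))]

theorem jointCumulant_eq_treeSum [IsProbabilityMeasure P] (hζ : IsCentredGaussian P ζ)
    (hf : ∀ A, f A ∈ supported ℝ {p : Var n N | p.1 ∈ A.1}) {m : ℕ}
    (hΘ : Θ.parts.card = m + 1) :
    jointCumulant P (fun A => polyVar (f A) ζ) = treeSum m Θ (recoupledMean P ζ (∏ A, f A)) := by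
  classical
  have h_card : Fintype.card {A // A ∈ Θ.parts} ≤ Fintype.card (Fin n) := by
    rw [Fintype.card_coe]
    exact Θ.card_parts_le_card
  rw [treeSum_eq_partitionCumulant hΘ, jointCumulant_eq_sum P _ h_card, partitionCumulant_apply]
  refine Finset.sum_congr rfl fun p _ => congrArg _ ?_
  rw [sum_colourings]
  exact Finset.sum_congr (by ext; simp) fun d _ =>
    (eval_partMatrix_recoupledMean_prod hζ hf d).symm

end Factorization

theorem treeSum_recoupledMean
    (hcov : ∀ p q, secondMoment P ζ p q = if p.2 = q.2 then bondCov P ζ s(p.1, q.1) else 0)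
    {Θ : SetPart n} (hΘ : Θ.parts.card = Θ.parts.card - 1 + 1) (g : MvPolynomial (Var n N) ℝ) :
    treeSum (Θ.parts.card - 1) Θ (recoupledMean P ζ g) =
      ∑ Γ ∈ trees Θ, (∏ b ∈ Γ, bondCov P ζ b) *
        ∫ Q, eval (entries Q) (recoupledMean P ζ (treeOp N Γ g)) ∂treeMeasure Θ Γ := by
  classical
  rw [treeSum, ← Finset.sum_fiberwise_of_maps_to (g := fun e => Finset.univ.image e) (t := trees Θ)
    fun e he => (joinsUp_iff_image_mem_trees hΘ e).1 (Finset.mem_filter.1 he).2]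
  refine Finset.sum_congr rfl fun Γ hΓ => ?_
  have h_joinsUp {e : Fin (Θ.parts.card - 1) → Sym2 (Fin n)} (he : Finset.univ.image e = Γ) :
      JoinsUp Θ e := (joinsUp_iff_image_mem_trees hΘ e).2 (he ▸ hΓ)
  rw [integral_treeMeasure (continuous_eval_entries _), Finset.mul_sum, Finset.filter_filter]
  refine Finset.sum_congr (Finset.filter_congr fun e _ => and_iff_right_of_imp h_joinsUp)
    fun e he => ?_
  obtain ⟨-, he⟩ := Finset.mem_filter.1 he
  rw [iterPDeriv_recoupledMean hcov (h_joinsUp he).injective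
    fun α hα => (h_joinsUp he).not_inBlock α (inBlock_of_isDiag Θ hα), he, ← integral_const_mul]
  simp only [smul_eval]

end RecoupledMean

end BKAR

end

theorem theorem3 {n N : ℕ} (hn : 0 < n) (hN : 0 < N) (Θ : SetPart n)
    (f : {A // A ∈ Θ.parts} → MvPolynomial (Var n N) ℝ)
    (hf : ∀ A, f A ∈ MvPolynomial.supported ℝ {p : Var n N | p.1 ∈ A.1})
    {Ω : Type*} [MeasurableSpace Ω] (P : Measure Ω) [IsProbabilityMeasure P]
    (ζ : Var n N → Ω → ℝ) (hζ : IsCentredGaussian P ζ)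
    (hcov : ∀ i i' j j', ∫ ω, ζ (i, j) ω * ζ (i', j') ω ∂P =
      if j = j' then ∫ ω, ζ (i, 0) ω * ζ (i', 0) ω ∂P else 0) :
    -- the cumulant is that of variables with absolute moments of all orders
    (∀ A (m : ℕ), Integrable (fun ω => |polyVar (f A) ζ ω| ^ m) P) ∧
    -- the recoupled family exists and has a uniquely determined law
    (∀ Q ∈ couplings n, ∃! ν : Measure (Var n N → ℝ), IsRecoupling P ζ Q ν fun p x => x p) ∧
    -- the tree measures are probability measures on the set of couplings
    (∀ Γ ∈ trees Θ, IsProbabilityMeasure (treeMeasure Θ Γ) ∧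
      ∀ᵐ Q ∂treeMeasure Θ Γ, Q ∈ couplings n) ∧
    -- for any choice of recoupled families the iterated integrals exist and the formula holds
    ∀ (Ω' : Matrix (Fin n) (Fin n) ℝ → Type*) [∀ Q, MeasurableSpace (Ω' Q)]
      (P' : ∀ Q, Measure (Ω' Q)) (ζ' : ∀ Q, Var n N → Ω' Q → ℝ),
      (∀ Q ∈ couplings n, IsRecoupling P ζ Q (P' Q) (ζ' Q)) →
      (∀ g : MvPolynomial (Var n N) ℝ,
        (∀ Q ∈ couplings n, Integrable (polyVar g (ζ' Q)) (P' Q)) ∧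
        ∀ Γ ∈ trees Θ,
          Integrable (fun Q => ∫ ω, polyVar g (ζ' Q) ω ∂P' Q) (treeMeasure Θ Γ)) ∧
      jointCumulant P (fun A => polyVar (f A) ζ) =
        ∑ Γ ∈ trees Θ, (∏ e ∈ Γ, bondCov P ζ e) *
          ∫ Q, (∫ ω, polyVar (treeOp N Γ (∏ A, f A)) (ζ' Q) ω ∂P' Q) ∂treeMeasure Θ Γ := by
  have hcard : Θ.parts.card = Θ.parts.card - 1 + 1 :=
    (Nat.sub_add_cancel (Finset.card_pos.2 (Θ.parts_nonempty
      (Finset.univ_nonempty_iff.2 ⟨⟨0, hn⟩⟩).ne_empty))).symm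
  refine ⟨fun A m => ?_, fun Q hQ => existsUnique_recoupling hζ hQ.1,
    fun Γ hΓ => ⟨isProbabilityMeasure_treeMeasure hΓ, ae_mem_couplings Θ Γ⟩,
    fun Ω' _ P' ζ' hζ' => ?_⟩
  · have h_moment := (hζ.integrable_eval (f A ^ m)).abs
    simpa only [polyVar, map_pow, abs_pow] using h_moment
  have h_mean (g : MvPolynomial (Var n N) ℝ) (Γ : Finset (Sym2 (Fin n))) :
      (fun Q => MvPolynomial.eval (entries Q) (recoupledMean P ζ g)) =ᵐ[treeMeasure Θ Γ]
        fun Q => ∫ ω, polyVar g (ζ' Q) ω ∂P' Q := by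
    filter_upwards [ae_mem_couplings Θ Γ] with Q hQ
    exact (integral_recoupling hQ (hζ' Q hQ) g).symm
  refine ⟨fun g => ⟨fun Q hQ => (hζ' Q hQ).centred.integrable_eval g, fun Γ _ => ?_⟩, ?_⟩
  · exact (integrable_treeMeasure (continuous_eval_entries _) Θ Γ).congr (h_mean g Γ)
  · rw [jointCumulant_eq_treeSum hζ hf hcard,
      treeSum_recoupledMean (fun p q => hcov p.1 q.1 p.2 q.2) hcard]
    exact Finset.sum_congr rfl fun Γ _ => by rw [integral_congr_ae (h_mean _ Γ)]
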